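/- Let $0<\beta<\alpha<\pi/2$, let $S_\gamma=\{z\in\mathbb C:\operatorname{Re}z>0,\ |\arg z|<\gamma\}$ and $V_\beta=\{z\in\mathbb C:\operatorname{Re}z>0,\ |\arg z|\le\beta\}$. Let $X$ be a complex Banach space and let $T=(T(t))_{t\in S_\alpha}$ be an analytic semigroup of bounded operators on $X$, that is, $t\mapsto T(t)\in\mathcal B(X)$ is analytic on $S_\alpha$ and $T(s+t)=T(s)T(t)$ for all $s,t\in S_\alpha$. Suppose that $T$ is nontrivial (not identically $0$), that $\sup_{t\in S_\alpha}\|T(t)\|<\infty$, and that every $T(t)$ is quasinilpotent (has spectral radius $0$). Let $\mu$ be a complex Borel measure supported on a compact set $K\subset V_\beta$, symmetric in the sense that $\mu(\overline S)=\overline{\mu(S)}$ for all Borel sets $S$, where $\overline S=\{\overline z:z\in S\}$, and with $\mu(K)=0$. Let $$F(z)=\int_K e^{-z\xi}\,d\mu(\xi)\qquad(z\in\mathbb C)$$ be its Fourier--Borel transform, and suppose that $F$ is not identically zero. For $u\in S_{\alpha-\beta}$ write $$F(-uA)=\int_K T(u\xi)\,d\mu(\xi),$$ a Bochner integral in $\mathcal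 B(X)$ ($A$ stands for the generator of $T$). Then $\sup_{t>0}|F(t)|<\infty$, and there is an $\eta>0$ such that, for all $u\in S_{\alpha-\beta}$ with $|u|\le\eta$, the integral defining $F(-uA)$ converges and $$\|F(-uA)\|>\sup_{t>0}|F(t)|.$$ -/

import Mathlib

open MeasureTheory

/-- The open sector `S_α = {z : Re z > 0, |arg z| < α}`. -/
def openSector (α : ℝ) : Set ℂ :=
  {z | 0 < z.re ∧ |z.arg| < α}

/-- The sector `V_β = {z : Re z > 0, |arg z| ≤ β}` (which does not contain `0`). -/
def closedSector (β : ℝ) : Set ℂ :=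
  {z | 0 < z.re ∧ |z.arg| ≤ β}

/-- The complex Borel measure `μ` is supported on `K`: it vanishes on every Borel set that is
disjoint from `K`. -/
def IsSupportedOn (μ : ComplexMeasure ℂ) (K : Set ℂ) : Prop :=
  ∀ S : Set ℂ, MeasurableSet S → Disjoint S K → μ S = 0

/-- `μ` is symmetric: the measure of the reflection of `S` in the real axis is the complex conjugate
of the measure of `S`. -/
def IsSymmetricMeasure (μ : ComplexMeasure ℂ) : Prop :=
  ∀ S : Set ℂ, MeasurableSet S →
    μ ((starRingEnd ℂ) ⁻¹' S) = (starRingEnd ℂ) (μ S)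

/-- The Bochner integral `∫ f(ξ) dμ(ξ)` of a function with values in a complex Banach space with
respect to a complex Borel measure on the plane. -/
noncomputable def complexIntegral {E : Type*} [NormedAddCommGroup E] [NormedSpace ℂ E]
    (μ : ComplexMeasure ℂ) (f : ℂ → E) : E :=
  μ.integral f (ContinuousLinearMap.lsmul ℝ ℂ (E := E)).flip

/-- The Fourier–Borel transform `z ↦ ∫ exp(-z ξ) dμ(ξ)`. -/
noncomputable def fourierBorel (μ : ComplexMeasure ℂ) (z : ℂ) : ℂ :=
  complexIntegral μ (fun ξ => Complex.exp (-z * ξ))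

/-- `T` (only its values on `S_α` matter) is an analytic semigroup of bounded operators on the
sector `S_α`. -/
structure IsAnalyticSemigroup {X : Type*} [NormedAddCommGroup X] [NormedSpace ℂ X]
    (α : ℝ) (T : ℂ → X →L[ℂ] X) : Prop where
  analytic : DifferentiableOn ℂ T (openSector α)
  map_add : ∀ s ∈ openSector α, ∀ t ∈ openSector α, T (s + t) = T s * T t

/-- The operator `F(-uA) = ∫ T(u ξ) dμ(ξ)`, where `F` is the Fourier–Borel transform of `μ` and
`A` is the generator of the semigroup `T`. -/
noncomputable def transformOfGenerator {X : Type*} [NormedAddCommGroup X] [NormedSpace ℂ X]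
    (μ : ComplexMeasure ℂ) (T : ℂ → X →L[ℂ] X) (u : ℂ) : X →L[ℂ] X :=
  complexIntegral μ (fun ξ => T (u * ξ))

/-! Since F vanishes at 0 and at +∞, m = sup |F(t)| over t > 0 is attained at some b > 0. Assume
‖F(-uA)‖ ≤ m. The contradiction for small u comes from the resolvent of the generator.
Quasinilpotency makes T(t) decay faster than every exponential, so L(s) = ∫₀^∞ e^{st} T(t) dt is
entire; it vanishes nowhere because T is nontrivial. For w in the sector, (1 - e^{sw} T(w)) L(s) is
an integral over the segment from 0 to w, of size O(|w|).

Put f(z) = u⁻¹ L(z/u). Taking s = z/u, w = uξ and integrating over μ gives (|F(z)| - m) ‖f(z)‖ ≤ D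
e^{κ|z|}, with D and κ independent of u (`sub_mul_norm_laplaceResolvent_le`). Letting w go to
infinity along a ray gives ‖f(z)‖ ≤ M / (-ℓ(z)) where ℓ = `dualSectorFun β` is negative
(`norm_laplaceResolvent_le`). So f is controlled where |F| > m and outside the sector ℓ ≥ 0.

These regions are joined by a polygon. At the real maximum b, |F| grows along some direction into
the upper half plane (`exists_direction_norm_growth`). By a Phragmén–Lindelöf argument, the
component of {im z > 0, |F| > m} reached in this way cannot stay in the sector ℓ ≥ 0, where F is
bounded (`exists_reachable_dualSectorFun_neg`); it contains some p with ℓ(p) < 0, and from p one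
goes straight to 0. Together with the mirror image, which is available because F commutes with
conjugation, this is a closed polygon through b and 0. The only singularities of the bounds on it
are removed by the weight z (z - b)^k. Cauchy's formula then bounds f on the part of a small circle
about 0 that lies inside the polygon; on the rest of the circle ℓ is negative and bounded away from
0 (`exists_uniform_bound_on_sphere`). By the maximum principle ‖L(0)‖ / |u| = ‖f(0)‖ ≤ C with C
independent of u, which fails for small u. -/

/-! ### Integration against a complex measure -/

section ComplexMeasure

variable {μ : ComplexMeasure ℂ} {K : Set ℂ}

theorem isFiniteMeasure_variation (μ : ComplexMeasure ℂ) : IsFiniteMeasure μ.variation := by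
  have hle : μ.variation ≤
      (ComplexMeasure.re μ).totalVariation + (ComplexMeasure.im μ).totalVariation := by
    refine VectorMeasure.variation_le_of_forall_enorm_le fun s _ => ?_
    have h : μ s = (ComplexMeasure.re μ s : ℂ) + (ComplexMeasure.im μ s : ℂ) * Complex.I := by
      exact (Complex.re_add_im (μ s)).symm
    rw [h, Measure.add_apply]
    refine (enorm_add_le _ _).trans (add_le_add ?_ ?_)
    · rw [← ofReal_norm, Complex.norm_real, ofReal_norm]
      exact SignedMeasure.enorm_le_totalVariation _ _
    · rw [enorm_mul, ← ofReal_norm Complex.I, Complex.norm_I, ← ofReal_norm, Complex.norm_real,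
        ofReal_norm]
      simpa using SignedMeasure.enorm_le_totalVariation (ComplexMeasure.im μ) s
  exact isFiniteMeasure_of_le _ hle

theorem IsSupportedOn.variation_compl_eq_zero (h : IsSupportedOn μ K) (hK : MeasurableSet K) :
    μ.variation Kᶜ = 0 := by
  rw [VectorMeasure.variation_apply_eq_zero hK.compl]
  intro t ht htm
  exact h t htm (Set.disjoint_left.2 fun x hx hxK => ht hx hxK)

theorem IsSupportedOn.ae_mem (h : IsSupportedOn μ K) (hK : MeasurableSet K) :
    ∀ᵐ x ∂μ.variation, x ∈ K := by
  rw [ae_iff]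
  exact h.variation_compl_eq_zero hK

theorem IsSupportedOn.apply_univ (h : IsSupportedOn μ K) (hK : MeasurableSet K) :
    μ Set.univ = μ K := by
  have h1 := VectorMeasure.of_union (v := μ) (disjoint_compl_right (a := K)) hK hK.compl
  rw [Set.union_compl_self, h Kᶜ hK.compl disjoint_compl_left, add_zero] at h1
  exact h1

variable {E : Type*} [NormedAddCommGroup E]

theorem IsSupportedOn.integrable (h : IsSupportedOn μ K) (hK : IsCompact K) {f : ℂ → E}
    (hf : ContinuousOn f K) : μ.Integrable f := by
  have := isFiniteMeasure_variation μ
  have hres : μ.variation.restrict K = μ.variation :=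
    Measure.restrict_eq_self_of_ae_mem (h.ae_mem hK.measurableSet)
  have h1 : IntegrableOn f K μ.variation := hf.integrableOn_compact hK
  rwa [IntegrableOn, hres] at h1

variable [NormedSpace ℂ E]

theorem IsSupportedOn.norm_complexIntegral_le (h : IsSupportedOn μ K) (hK : MeasurableSet K)
    {f : ℂ → E} {C : ℝ} (hf : ∀ x ∈ K, ‖f x‖ ≤ C) :
    ‖complexIntegral μ f‖ ≤ C * μ.variation.real Set.univ := by
  have := isFiniteMeasure_variation μ
  -- For empty K the constant C may be negative; both sides are then 0.
  rcases Set.eq_empty_or_nonempty K with rfl | ⟨x, hx⟩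
  · have h0 : μ.variation = 0 := by
      have := h.variation_compl_eq_zero hK
      simpa using this
    have : complexIntegral μ f = 0 :=
      VectorMeasure.integral_eq_zero_of_ae (by rw [h0, ae_zero]; exact Filter.eventually_bot)
    simp [this, h0]
  have hC : 0 ≤ C := (norm_nonneg _).trans (hf x hx)
  have hB : ‖(ContinuousLinearMap.lsmul ℝ ℂ (E := E)).flip‖ ≤ 1 := by
    refine ContinuousLinearMap.opNorm_le_bound₂ _ zero_le_one fun x y => ?_
    simp [norm_smul, mul_comm]
  refine (VectorMeasure.norm_integral_le_of_norm_le_const (C := C) ?_).trans ?_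
  · filter_upwards [h.ae_mem hK] with x hx using hf x hx
  · calc C * _ * μ.variation.real Set.univ ≤ C * 1 * μ.variation.real Set.univ := by gcongr
      _ = _ := by ring

theorem complexIntegral_const [CompleteSpace E] (μ : ComplexMeasure ℂ) (c : E) :
    complexIntegral μ (fun _ => c) = μ Set.univ • c := by
  have := isFiniteMeasure_variation μ
  simp [complexIntegral]

theorem complexIntegral_sub {f g : ℂ → E} (hf : μ.Integrable f) (hg : μ.Integrable g) :
    complexIntegral μ (fun x => f x - g x) = complexIntegral μ f - complexIntegral μ g :=
  VectorMeasure.integral_fun_sub hf hg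

variable {G : Type*} [NormedAddCommGroup G] [NormedSpace ℂ G]

theorem ContinuousLinearMap.complexIntegral_comp_comm [CompleteSpace E] [CompleteSpace G]
    (L : E →L[ℂ] G) {f : ℂ → E} (hf : μ.Integrable f) :
    complexIntegral μ (fun x => L (f x)) = L (complexIntegral μ f) := by
  have h1 := VectorMeasure.continuousLinearMap_apply_integral
    (B := (ContinuousLinearMap.lsmul ℝ ℂ (E := E)).flip) (C := L.restrictScalars ℝ) hf
  have h2 := VectorMeasure.integral_continuousLinearMap_comp
    (B := (ContinuousLinearMap.lsmul ℝ ℂ (E := G)).flip) (C := L.restrictScalars ℝ) hf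
  refine h2.trans (Eq.trans ?_ h1.symm)
  congr 1
  ext x y
  simp

/-- Symmetry says that the push-forward of μ under conjugation is the conjugate of μ. The two have
the same variation, so it suffices to compare the integrals as extensions of set functions, where
the identity is conj (μ s • x) = conj (μ s) • conj x. -/
theorem integral_conj_of_isSymmetricMeasure (h : IsSymmetricMeasure μ) {f : ℂ → ℂ}
    (hf : μ.Integrable f) :
    (starRingEnd ℂ) (complexIntegral μ f) =
      complexIntegral μ (fun x => (starRingEnd ℂ) (f ((starRingEnd ℂ) x))) := by
  let e : ℂ ≃ᵐ ℂ := Complex.conjCLE.toHomeomorph.toMeasurableEquiv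
  let cc : ℂ →L[ℝ] ℂ := (Complex.conjCLE : ℂ →L[ℝ] ℂ)
  let B : ℂ →L[ℝ] ℂ →L[ℝ] ℂ := (ContinuousLinearMap.lsmul ℝ ℂ (E := ℂ)).flip
  have hmap : ∀ s, MeasurableSet s → μ.map e s = (starRingEnd ℂ) (μ s) := fun s hs => by
    rw [VectorMeasure.map_apply _ e.measurable hs]
    exact h s hs
  have hvar : (μ.map e).variation = μ.variation := by
    refine le_antisymm (VectorMeasure.variation_le_of_forall_enorm_le fun s hs => ?_)
      (VectorMeasure.variation_le_of_forall_enorm_le fun s hs => ?_)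
    · rw [hmap s hs, ← ofReal_norm, RCLike.norm_conj, ofReal_norm]
      exact VectorMeasure.enorm_measure_le_variation μ s
    · refine le_trans (le_of_eq ?_) (VectorMeasure.enorm_measure_le_variation (μ.map e) s)
      rw [hmap s hs, ← ofReal_norm, ← ofReal_norm, RCLike.norm_conj]
  have hf' : (μ.map e).Integrable f := by rwa [VectorMeasure.Integrable, hvar]
  have h1 := VectorMeasure.continuousLinearMap_apply_integral (B := B) (C := cc) hf
  have h2 := VectorMeasure.integral_continuousLinearMap_comp (B := B) (C := cc) hf'
  have h3 := VectorMeasure.integral_map_equiv (μ := μ) (B := B) e (fun y => cc (f y))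
  refine h1.trans (Eq.trans ?_ (h2.symm.trans h3))
  have key : ∀ s, MeasurableSet s →
      (μ.transpose ((ContinuousLinearMap.compL ℝ ℂ ℂ ℂ cc) ∘L B)) s =
        ((μ.map e).transpose (B ∘L cc)) s := fun s hs => by
    refine ContinuousLinearMap.ext fun x => ?_
    change cc (B x (μ s)) = B (cc x) (μ.map e s)
    rw [hmap s hs]
    change (starRingEnd ℂ) (μ s • x) = (starRingEnd ℂ) (μ s) • (starRingEnd ℂ) x
    simp
  have hdom := dominatedFinMeasAdditive_cbmApplyMeasure (μ.map e) (B ∘L cc)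
  have hdom' : DominatedFinMeasAdditive μ.variation ((μ.map e).transpose (B ∘L cc)) ‖B ∘L cc‖ := by
    rwa [← hvar]
  rw [VectorMeasure.integral_eq_setToFun, VectorMeasure.integral_eq_setToFun]
  exact (setToFun_congr_left' _ hdom' (fun s hs _ => key s hs) f).trans
    (setToFun_congr_measure 1 1 ENNReal.one_ne_top ENNReal.one_ne_top
      (by rw [hvar, one_smul]) (by rw [hvar, one_smul]) hdom' hdom f)

end ComplexMeasure

/-! ### The Fourier–Borel transform as an entire function -/

section FourierBorel

variable {μ : ComplexMeasure ℂ} {K : Set ℂ}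

theorem IsSupportedOn.integrable_exp (h : IsSupportedOn μ K) (hK : IsCompact K) (z : ℂ) :
    μ.Integrable (fun ξ => Complex.exp (-z * ξ)) :=
  h.integrable hK (by fun_prop)

theorem IsSupportedOn.norm_fourierBorel_le (h : IsSupportedOn μ K) (hK : IsCompact K) {z : ℂ}
    {c : ℝ} (hc : ∀ ξ ∈ K, c ≤ (z * ξ).re) :
    ‖fourierBorel μ z‖ ≤ Real.exp (-c) * μ.variation.real Set.univ := by
  refine h.norm_complexIntegral_le hK.measurableSet fun ξ hξ => ?_
  rw [Complex.norm_exp, Real.exp_le_exp, neg_mul, Complex.neg_re]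
  exact neg_le_neg (hc ξ hξ)

theorem IsSupportedOn.fourierBorel_zero (h : IsSupportedOn μ K) (hK : IsCompact K)
    (hmass : μ K = 0) : fourierBorel μ 0 = 0 := by
  have : (fun ξ : ℂ => Complex.exp (-0 * ξ)) = fun _ => 1 := by
    ext; simp
  rw [fourierBorel, this, complexIntegral_const, h.apply_univ hK.measurableSet, hmass, zero_smul]

theorem IsSupportedOn.fourierBorel_conj (h : IsSupportedOn μ K) (hK : IsCompact K)
    (hsymm : IsSymmetricMeasure μ) (z : ℂ) :
    fourierBorel μ ((starRingEnd ℂ) z) = (starRingEnd ℂ) (fourierBorel μ z) := by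
  rw [fourierBorel, fourierBorel,
    integral_conj_of_isSymmetricMeasure hsymm (h.integrable_exp hK z)]
  congr 1
  ext ξ
  rw [← Complex.exp_conj]
  simp

theorem IsSupportedOn.differentiable_fourierBorel (h : IsSupportedOn μ K) (hK : IsCompact K) :
    Differentiable ℂ (fourierBorel μ) := by
  intro z
  obtain ⟨R, hR0, hR⟩ : ∃ R : ℝ, 0 < R ∧ ∀ ξ ∈ K, ‖ξ‖ ≤ R := by
    obtain ⟨R, hR⟩ := hK.isBounded.exists_norm_le
    exact ⟨max R 1, by positivity, fun ξ hξ => (hR ξ hξ).trans (le_max_left _ _)⟩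
  set D : ℂ := complexIntegral μ fun ξ => -ξ * Complex.exp (-z * ξ)
  have hD : μ.Integrable fun ξ => -ξ * Complex.exp (-z * ξ) := h.integrable hK (by fun_prop)
  refine HasDerivAt.differentiableAt (f' := D) ?_
  rw [hasDerivAt_iff_isLittleO_nhds_zero]
  -- The remainder is quadratic, by |e^w - 1 - w| ≤ |w|² for |w| ≤ 1 with w = -kξ; the radius 1/R of
  -- the ball for k ensures |w| ≤ 1 on K.
  refine Asymptotics.IsBigO.trans_isLittleO (g := fun k : ℂ => k ^ 2) ?_
    (Asymptotics.isLittleO_pow_id one_lt_two)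
  refine Asymptotics.IsBigO.of_bound (Real.exp (‖z‖ * R) * R ^ 2 * μ.variation.real Set.univ) ?_
  filter_upwards [Metric.ball_mem_nhds (0 : ℂ) (inv_pos.2 hR0)] with k hk
  have hk' : ‖k‖ * R ≤ 1 := by
    rw [mem_ball_zero_iff] at hk
    calc ‖k‖ * R ≤ R⁻¹ * R := by gcongr
      _ = 1 := inv_mul_cancel₀ hR0.ne'
  have hkD : k • D = complexIntegral μ fun ξ => k • (-ξ * Complex.exp (-z * ξ)) :=
    ((k • ContinuousLinearMap.id ℂ ℂ).complexIntegral_comp_comm hD).symm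
  have heq : fourierBorel μ (z + k) - fourierBorel μ z - k • D =
      complexIntegral μ fun ξ => Complex.exp (-(z + k) * ξ) - Complex.exp (-z * ξ) -
        k • (-ξ * Complex.exp (-z * ξ)) := by
    rw [complexIntegral_sub, complexIntegral_sub, ← hkD]
    · rfl
    · exact h.integrable_exp hK _
    · exact h.integrable_exp hK _
    · exact (h.integrable_exp hK _).sub (h.integrable_exp hK _)
    · exact hD.smul k
  rw [heq]
  refine (h.norm_complexIntegral_le hK.measurableSet
    (C := Real.exp (‖z‖ * R) * R ^ 2 * ‖k ^ 2‖) fun ξ hξ => ?_).trans (le_of_eq (by ring))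
  have hfac : Complex.exp (-(z + k) * ξ) - Complex.exp (-z * ξ) -
      k • (-ξ * Complex.exp (-z * ξ)) =
      Complex.exp (-z * ξ) * (Complex.exp (-k * ξ) - 1 - (-k * ξ)) := by
    rw [show -(z + k) * ξ = -z * ξ + -k * ξ by ring, Complex.exp_add, smul_eq_mul]
    ring
  have hkξ : ‖-k * ξ‖ ≤ ‖k‖ * R := by
    rw [norm_mul, norm_neg]
    gcongr
    exact hR ξ hξ
  rw [hfac, norm_mul]
  calc _ ≤ Real.exp (‖z‖ * R) * ‖-k * ξ‖ ^ 2 := by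
        gcongr
        · rw [Complex.norm_exp, Real.exp_le_exp]
          refine (Complex.re_le_norm _).trans ?_
          rw [norm_mul, norm_neg]
          gcongr
          exact hR ξ hξ
        · exact Complex.norm_exp_sub_one_sub_id_le (hkξ.trans hk')
    _ ≤ Real.exp (‖z‖ * R) * (‖k‖ * R) ^ 2 := by gcongr
    _ = _ := by rw [norm_pow]; ring

end FourierBorel

/-! ### Geometry of sectors -/

section Sectors

variable {α β : ℝ} {z w : ℂ}

/-- The sign of the sine turns a condition on the argument into a linear inequality between `re` and
`|im|`, from which openness and stability under addition are immediate. -/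
theorem norm_mul_sin_abs_arg_sub (z : ℂ) (α : ℝ) :
    ‖z‖ * Real.sin (|z.arg| - α) = |z.im| * Real.cos α - z.re * Real.sin α := by
  have h1 : ‖z‖ * Real.cos |z.arg| = z.re := by rw [Real.cos_abs, Complex.norm_mul_cos_arg]
  have h2 : ‖z‖ * Real.sin |z.arg| = |z.im| := by
    rw [← Complex.norm_mul_sin_arg, abs_mul, abs_norm,
      Real.abs_sin_eq_sin_abs_of_abs_le_pi (Complex.abs_arg_le_pi z)]
  rw [Real.sin_sub, mul_sub, ← mul_assoc, ← mul_assoc, h1, h2]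

theorem mem_openSector_iff (h0 : 0 < α) (h1 : α < Real.pi / 2) :
    z ∈ openSector α ↔ |z.im| * Real.cos α < z.re * Real.sin α := by
  have hs : 0 < Real.sin α := Real.sin_pos_of_pos_of_lt_pi h0 (by linarith [Real.pi_pos])
  have hc : 0 < Real.cos α := Real.cos_pos_of_mem_Ioo ⟨by linarith, h1⟩
  have key := norm_mul_sin_abs_arg_sub z α
  constructor
  · rintro ⟨hre, harg⟩
    have hz : 0 < ‖z‖ := norm_pos_iff.2 fun h => by simp [h] at hre
    have : Real.sin (|z.arg| - α) < 0 :=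
      Real.sin_neg_of_neg_of_neg_pi_lt (by linarith) (by linarith [abs_nonneg z.arg, Real.pi_pos])
    nlinarith
  · intro h
    have hre : 0 < z.re := by
      by_contra hneg
      nlinarith [abs_nonneg z.im, mul_nonneg (abs_nonneg z.im) hc.le]
    refine ⟨hre, ?_⟩
    by_contra hge
    have : 0 ≤ Real.sin (|z.arg| - α) :=
      Real.sin_nonneg_of_nonneg_of_le_pi (by linarith) (by linarith [Complex.abs_arg_le_pi z])
    nlinarith [norm_nonneg z]

theorem mem_closedSector_iff (h0 : 0 < β) (h1 : β < Real.pi / 2) :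
    z ∈ closedSector β ↔ 0 < z.re ∧ |z.im| * Real.cos β ≤ z.re * Real.sin β := by
  have key := norm_mul_sin_abs_arg_sub z β
  refine and_congr_right fun hre => ?_
  have hz : 0 < ‖z‖ := norm_pos_iff.2 fun h => by simp [h] at hre
  have harg : |z.arg| < Real.pi / 2 := Complex.abs_arg_lt_pi_div_two_iff.2 (Or.inl hre)
  constructor
  · intro harg
    have : Real.sin (|z.arg| - β) ≤ 0 :=
      Real.sin_nonpos_of_nonpos_of_neg_pi_le (by linarith)
        (by linarith [abs_nonneg z.arg, Real.pi_pos])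
    nlinarith
  · intro h
    by_contra hgt
    have : 0 < Real.sin (|z.arg| - β) :=
      Real.sin_pos_of_pos_of_lt_pi (by linarith) (by linarith [Real.pi_pos])
    nlinarith

theorem isOpen_openSector (h0 : 0 < α) (h1 : α < Real.pi / 2) : IsOpen (openSector α) := by
  have : openSector α = {z : ℂ | |z.im| * Real.cos α < z.re * Real.sin α} :=
    Set.ext fun z => mem_openSector_iff h0 h1
  rw [this]
  exact isOpen_lt (by fun_prop) (by fun_prop)

theorem add_mem_openSector (h0 : 0 < α) (h1 : α < Real.pi / 2) (hz : z ∈ openSector α)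
    (hw : w ∈ openSector α) : z + w ∈ openSector α := by
  rw [mem_openSector_iff h0 h1] at *
  have hc : 0 < Real.cos α := Real.cos_pos_of_mem_Ioo ⟨by linarith, h1⟩
  rw [Complex.add_re, Complex.add_im]
  nlinarith [mul_le_mul_of_nonneg_right (abs_add_le z.im w.im) hc.le]

theorem real_mul_mem_openSector {r : ℝ} (hr : 0 < r) (hz : z ∈ openSector α) :
    (r : ℂ) * z ∈ openSector α := by
  refine ⟨by simpa using mul_pos hr hz.1, ?_⟩
  rw [Complex.arg_real_mul _ hr]
  exact hz.2

theorem ofReal_mem_openSector (h0 : 0 < α) {r : ℝ} (hr : 0 < r) : (r : ℂ) ∈ openSector α :=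
  ⟨by simpa using hr, by simpa [Complex.arg_ofReal_of_nonneg hr.le] using h0⟩

theorem mul_mem_openSector (hα : α < Real.pi / 2) (hz : z ∈ openSector (α - β))
    (hw : w ∈ closedSector β) : z * w ∈ openSector α := by
  have hz0 : z ≠ 0 := fun h => by simpa [h] using hz.1
  have hw0 : w ≠ 0 := fun h => by simpa [h] using hw.1
  have habs : |z.arg + w.arg| < α := by
    linarith [abs_add_le z.arg w.arg, hz.2, hw.2]
  have habs' := abs_lt.1 (habs.trans hα)
  have harg : (z * w).arg = z.arg + w.arg :=
    Complex.arg_mul hz0 hw0 ⟨by linarith [Real.pi_pos], by linarith [Real.pi_pos]⟩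
  have h2 : |(z * w).arg| < α := by rwa [harg]
  refine ⟨?_, h2⟩
  exact (Complex.abs_arg_lt_pi_div_two_iff.1 (h2.trans hα)).resolve_right (mul_ne_zero hz0 hw0)

end Sectors

/-! ### Superexponential decay of a quasinilpotent semigroup -/

section Semigroup

/-- `T` is an analytic semigroup on the sector `S_α` with values in a Banach algebra. -/
structure IsAlgAnalyticSemigroup {A : Type*} [NormedRing A] [NormedAlgebra ℂ A]
    (α : ℝ) (T : ℂ → A) : Prop where
  analytic : DifferentiableOn ℂ T (openSector α)
  map_add : ∀ s ∈ openSector α, ∀ t ∈ openSector α, T (s + t) = T s * T t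

variable {A : Type*} [NormedRing A] [NormedAlgebra ℂ A] {α M : ℝ} {T : ℂ → A}

theorem IsAlgAnalyticSemigroup.map_nat_add (hT : IsAlgAnalyticSemigroup α T) (h0 : 0 < α) (n : ℕ)
    {r : ℝ} (hr : 0 < r) : T ((n + r : ℝ) : ℂ) = T 1 ^ n * T (r : ℂ) := by
  induction n with
  | zero => simp
  | succ n ih =>
    have h1 : (1 : ℂ) ∈ openSector α := by
      simpa using ofReal_mem_openSector h0 one_pos
    have h2 : ((n + r : ℝ) : ℂ) ∈ openSector α := ofReal_mem_openSector h0 (by positivity)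
    rw [show ((((n + 1 : ℕ) : ℝ) + r : ℝ) : ℂ) = 1 + ((n + r : ℝ) : ℂ) by push_cast; ring,
      hT.map_add _ h1 _ h2, ih, pow_succ', mul_assoc]

theorem norm_pow_le_of_spectralRadius_eq_zero [CompleteSpace A] {x : A} (hx : spectralRadius ℂ x = 0) {ε : ℝ} (hε : 0 < ε) :
    ∀ᶠ n : ℕ in Filter.atTop, ‖x ^ n‖ ≤ ε ^ n := by
  have h := spectrum.pow_norm_pow_one_div_tendsto_nhds_spectralRadius x
  rw [hx] at h
  filter_upwards [h.eventually (gt_mem_nhds (ENNReal.ofReal_pos.2 hε)),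
    Filter.eventually_gt_atTop 0] with n hn hn0
  have h1 : ‖x ^ n‖ ^ (1 / (n : ℝ)) < ε := (ENNReal.ofReal_lt_ofReal_iff hε).1 hn
  have hn0' : (n : ℝ) ≠ 0 := by exact_mod_cast hn0.ne'
  calc ‖x ^ n‖ = (‖x ^ n‖ ^ (1 / (n : ℝ))) ^ n := by
        rw [← Real.rpow_natCast, ← Real.rpow_mul (norm_nonneg _), one_div_mul_cancel hn0',
          Real.rpow_one]
    _ ≤ ε ^ n := by gcongr

variable [CompleteSpace A]

theorem IsAlgAnalyticSemigroup.exists_norm_le_exp (hT : IsAlgAnalyticSemigroup α T) (h0 : 0 < α)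
    (hM : ∀ t ∈ openSector α, ‖T t‖ ≤ M) (hq : spectralRadius ℂ (T 1) = 0) {a : ℝ}
    (ha : 0 ≤ a) : ∃ C, ∀ t : ℝ, 0 < t → ‖T t‖ ≤ C * Real.exp (-a * t) := by
  obtain ⟨N, hN⟩ := Filter.eventually_atTop.1
    (norm_pow_le_of_spectralRadius_eq_zero hq (Real.exp_pos (-a)))
  have hM0 : 0 ≤ M := (norm_nonneg _).trans (hM _ (ofReal_mem_openSector h0 one_pos))
  -- The factor pays for e^{-at} when t ≤ N + 1, and for the loss e^{a(t - n)} ≤ e^a when t is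
  -- larger.
  refine ⟨M * Real.exp (a * (N + 1)), fun t ht => ?_⟩
  have htM := hM _ (ofReal_mem_openSector h0 ht)
  rcases le_or_gt t (N + 1) with hle | hgt
  · refine htM.trans ?_
    rw [mul_assoc, ← Real.exp_add]
    refine le_mul_of_one_le_right hM0 (Real.one_le_exp ?_)
    nlinarith
  -- Not the floor of t: the remainder t - n must lie in (0, 1], since the sector omits 0.
  · set n : ℕ := ⌈t⌉₊ - 1
    have hceil : 0 < ⌈t⌉₊ := Nat.ceil_pos.2 ht
    have hn : (n : ℝ) + 1 = (⌈t⌉₊ : ℝ) := by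
      have : n + 1 = ⌈t⌉₊ := Nat.sub_add_cancel hceil
      exact_mod_cast this
    have h1 : (n : ℝ) < t := by linarith [Nat.ceil_lt_add_one ht.le]
    have h2 : t ≤ n + 1 := by rw [hn]; exact Nat.le_ceil t
    have hNn : N ≤ n := by
      have : (N : ℝ) < n := by linarith
      exact_mod_cast this.le
    have hr : 0 < t - n := by linarith
    have heq : T (t : ℂ) = T 1 ^ n * T ((t - n : ℝ) : ℂ) := by
      rw [← hT.map_nat_add h0 n hr]
      congr 2
      ring
    rw [heq]
    calc _ ≤ ‖T 1 ^ n‖ * ‖T ((t - n : ℝ) : ℂ)‖ := norm_mul_le _ _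
      _ ≤ Real.exp (-a) ^ n * M := by
        gcongr
        · exact hN n hNn
        · exact hM _ (ofReal_mem_openSector h0 hr)
      _ = M * Real.exp (-a * n) := by rw [← Real.exp_nat_mul]; ring_nf
      _ ≤ M * (Real.exp (a * (N + 1)) * Real.exp (-a * t)) := by
        rw [← Real.exp_add]
        gcongr
        nlinarith [mul_nonneg ha (Nat.cast_nonneg (α := ℝ) N)]
      _ = _ := by ring

end Semigroup

/-! ### The Laplace integral and its functional equation -/

section Semigroup

variable {A : Type*} [NormedRing A] [NormedAlgebra ℂ A] {α M : ℝ} {T : ℂ → A}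

/-- The Laplace integral `∫₀^∞ exp(s t) T(t) dt`, i.e. minus the resolvent of the generator of `T`
at `-s`. -/
noncomputable def laplaceResolvent (T : ℂ → A) (s : ℂ) : A :=
  ∫ t in Set.Ioi (0 : ℝ), Complex.exp (s * t) • T t

theorem IsAlgAnalyticSemigroup.continuousOn_ofReal_add (hT : IsAlgAnalyticSemigroup α T) (h0 : 0 < α)
    (hα : α < Real.pi / 2) {z : ℂ} (hz : z ∈ openSector α) (s : ℂ) :
    ContinuousOn (fun t : ℝ => Complex.exp (s * (z + t)) • T (z + t)) (Set.Ici 0) := by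
  have h1 : ContinuousOn (fun t : ℝ => Complex.exp (s * (z + t))) (Set.Ici 0) := by fun_prop
  have h2 : ContinuousOn (fun t : ℝ => z + (t : ℂ)) (Set.Ici 0) := by fun_prop
  refine h1.smul (hT.analytic.continuousOn.comp h2 ?_)
  intro t ht
  rcases (Set.mem_Ici.1 ht).eq_or_lt with rfl | h
  · simpa using hz
  · exact add_mem_openSector h0 hα hz (ofReal_mem_openSector h0 h)

theorem IsAlgAnalyticSemigroup.continuousOn_ofReal (hT : IsAlgAnalyticSemigroup α T) (h0 : 0 < α)
    (s : ℂ) : ContinuousOn (fun t : ℝ => Complex.exp (s * t) • T t) (Set.Ioi 0) := by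
  have h1 : ContinuousOn (fun t : ℝ => Complex.exp (s * t)) (Set.Ioi 0) := by fun_prop
  exact h1.smul (hT.analytic.continuousOn.comp Complex.continuous_ofReal.continuousOn
    fun _ ht => ofReal_mem_openSector h0 ht)

theorem norm_exp_mul_ofReal_le (s : ℂ) {t : ℝ} (ht : 0 ≤ t) :
    ‖Complex.exp (s * t)‖ ≤ Real.exp (‖s‖ * t) := by
  rw [Complex.norm_exp, Real.exp_le_exp, Complex.re_mul_ofReal]
  exact mul_le_mul_of_nonneg_right (Complex.re_le_norm s) ht

variable [CompleteSpace A]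

theorem IsAlgAnalyticSemigroup.integrableOn_laplace (hT : IsAlgAnalyticSemigroup α T) (h0 : 0 < α)
    (hM : ∀ t ∈ openSector α, ‖T t‖ ≤ M) (hq : spectralRadius ℂ (T 1) = 0) (s : ℂ) :
    IntegrableOn (fun t : ℝ => Complex.exp (s * t) • T t) (Set.Ioi 0) := by
  obtain ⟨C, hC⟩ := hT.exists_norm_le_exp h0 hM hq (a := ‖s‖ + 1) (by positivity)
  refine Integrable.mono' (g := fun t => C * Real.exp (-1 * t))
    ((integrableOn_exp_mul_Ioi (by norm_num) 0).const_mul C)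
    ((hT.continuousOn_ofReal h0 s).aestronglyMeasurable measurableSet_Ioi) ?_
  refine (ae_restrict_mem measurableSet_Ioi).mono fun t ht => ?_
  rw [norm_smul]
  calc _ ≤ Real.exp (‖s‖ * t) * (C * Real.exp (-(‖s‖ + 1) * t)) := by
        gcongr
        · exact norm_exp_mul_ofReal_le s (le_of_lt ht)
        · exact hC t ht
    _ = C * (Real.exp (‖s‖ * t) * Real.exp (-(‖s‖ + 1) * t)) := by ring
    _ = C * Real.exp (-1 * t) := by rw [← Real.exp_add]; ring_nf

theorem IsAlgAnalyticSemigroup.differentiable_laplaceResolvent (hT : IsAlgAnalyticSemigroup α T)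
    (h0 : 0 < α) (hM : ∀ t ∈ openSector α, ‖T t‖ ≤ M) (hq : spectralRadius ℂ (T 1) = 0) :
    Differentiable ℂ (laplaceResolvent T) := by
  intro s
  -- Of the extra rate 3, one unit pays for the unit ball around s, one for the factor t ≤ e^t, and
  -- one is left for integrability.
  obtain ⟨C, hC⟩ := hT.exists_norm_le_exp h0 hM hq (a := ‖s‖ + 3) (by positivity)
  refine (hasDerivAt_integral_of_dominated_loc_of_deriv_le
    (F := fun (s : ℂ) (t : ℝ) => Complex.exp (s * t) • T t)
    (F' := fun (s : ℂ) (t : ℝ) => (Complex.exp (s * t) * t) • T t)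
    (bound := fun t => C * Real.exp (-1 * t))
    (Metric.ball_mem_nhds s one_pos) ?_ ?_ ?_ ?_ ?_ ?_).2.differentiableAt
  · exact Filter.Eventually.of_forall fun s =>
      (hT.continuousOn_ofReal h0 s).aestronglyMeasurable measurableSet_Ioi
  · exact hT.integrableOn_laplace h0 hM hq s
  · refine ContinuousOn.aestronglyMeasurable ?_ measurableSet_Ioi
    have h1 : ContinuousOn (fun t : ℝ => Complex.exp (s * t) * t) (Set.Ioi 0) := by fun_prop
    exact h1.smul (hT.analytic.continuousOn.comp Complex.continuous_ofReal.continuousOn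
      fun _ ht => ofReal_mem_openSector h0 ht)
  · refine (ae_restrict_mem measurableSet_Ioi).mono fun t ht w hw => ?_
    have ht0 : 0 < t := ht
    have hw' : ‖w‖ ≤ ‖s‖ + 1 := by
      rw [Metric.mem_ball, dist_eq_norm] at hw
      linarith [norm_le_norm_add_norm_sub' w s]
    have hexp : ‖Complex.exp (w * t) * t‖ ≤ Real.exp ((‖s‖ + 1) * t) * Real.exp t := by
      rw [norm_mul]
      gcongr
      · exact (norm_exp_mul_ofReal_le w ht0.le).trans (by gcongr)
      · rw [Complex.norm_real, Real.norm_of_nonneg ht0.le]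
        linarith [Real.add_one_le_exp t]
    rw [norm_smul]
    calc _ ≤ (Real.exp ((‖s‖ + 1) * t) * Real.exp t) * (C * Real.exp (-(‖s‖ + 3) * t)) := by
          gcongr
          exact hC t ht
      _ = C * (Real.exp ((‖s‖ + 1) * t) * Real.exp t * Real.exp (-(‖s‖ + 3) * t)) := by ring
      _ = C * Real.exp (-1 * t) := by rw [← Real.exp_add, ← Real.exp_add]; ring_nf
  · exact (integrableOn_exp_mul_Ioi (by norm_num) 0).const_mul C
  · refine Filter.Eventually.of_forall fun t w _ => ?_
    have h := ((hasDerivAt_id w).mul_const (t : ℂ)).cexp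
    simpa using h.smul_const (T t)

/-- The translated Laplace integral. -/
theorem IsAlgAnalyticSemigroup.smul_mul_laplaceResolvent (hT : IsAlgAnalyticSemigroup α T)
    (h0 : 0 < α) (hM : ∀ t ∈ openSector α, ‖T t‖ ≤ M) (hq : spectralRadius ℂ (T 1) = 0)
    {z : ℂ} (hz : z ∈ openSector α) (s : ℂ) :
    Complex.exp (s * z) • (T z * laplaceResolvent T s) =
      ∫ t in Set.Ioi (0 : ℝ), Complex.exp (s * (z + t)) • T (z + t) := by
  rw [laplaceResolvent, ← integral_const_mul_of_integrable (hT.integrableOn_laplace h0 hM hq s),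
    ← integral_smul]
  refine setIntegral_congr_fun measurableSet_Ioi fun t ht => ?_
  rw [hT.map_add z hz t (ofReal_mem_openSector h0 ht), mul_add, Complex.exp_add, mul_smul_comm,
    smul_smul]

theorem IsAlgAnalyticSemigroup.integrableOn_laplace_add (hT : IsAlgAnalyticSemigroup α T)
    (h0 : 0 < α) (hM : ∀ t ∈ openSector α, ‖T t‖ ≤ M) (hq : spectralRadius ℂ (T 1) = 0)
    {z : ℂ} (hz : z ∈ openSector α) (s : ℂ) :
    IntegrableOn (fun t : ℝ => Complex.exp (s * (z + t)) • T (z + t)) (Set.Ioi 0) := by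
  have h := ((hT.integrableOn_laplace h0 hM hq s).const_mul (T z)).smul (Complex.exp (s * z))
  refine IntegrableOn.congr_fun h (fun t ht => ?_) measurableSet_Ioi
  simp only [Pi.smul_apply]
  rw [hT.map_add z hz t (ofReal_mem_openSector h0 ht), mul_add, Complex.exp_add, mul_smul_comm,
    smul_smul]

theorem setIntegral_Ioi_comp_add_right {E : Type*} [NormedAddCommGroup E] [NormedSpace ℝ E]
    (g : ℝ → E) (a h : ℝ) : ∫ t in Set.Ioi a, g (t + h) = ∫ t in Set.Ioi (a + h), g t := by
  have := (measurePreserving_add_right volume h).setIntegral_preimage_emb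
    (MeasurableEquiv.addRight h).measurableEmbedding g (Set.Ioi (a + h))
  simpa using this

/-- Under z ↦ z + h with h ≥ 0 the function is the tail from h of a convergent integral, so its
right derivative at h = 0 is minus the integrand there. The function is holomorphic in z, hence this
one-sided real derivative is the complex one. -/
theorem IsAlgAnalyticSemigroup.hasDerivAt_smul_mul_laplaceResolvent (hT : IsAlgAnalyticSemigroup α T)
    (h0 : 0 < α) (hα : α < Real.pi / 2) (hM : ∀ t ∈ openSector α, ‖T t‖ ≤ M)
    (hq : spectralRadius ℂ (T 1) = 0) {z : ℂ} (hz : z ∈ openSector α) (s : ℂ) :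
    HasDerivAt (fun z => Complex.exp (s * z) • (T z * laplaceResolvent T s))
      (-(Complex.exp (s * z) • T z)) z := by
  set y : ℂ → A := fun z => Complex.exp (s * z) • (T z * laplaceResolvent T s) with hy
  set g : ℝ → A := fun t => Complex.exp (s * (z + t)) • T (z + t) with hg
  have hyd : DifferentiableAt ℂ y z := by
    have hTz : DifferentiableAt ℂ T z :=
      (hT.analytic z hz).differentiableAt ((isOpen_openSector h0 hα).mem_nhds hz)
    have he : DifferentiableAt ℂ (fun z => Complex.exp (s * z)) z := by fun_prop
    exact he.smul (hTz.mul_const _)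
  have hgi : IntegrableOn g (Set.Ioi 0) := hT.integrableOn_laplace_add h0 hM hq hz s
  have hgc : ContinuousOn g (Set.Ici 0) := hT.continuousOn_ofReal_add h0 hα hz s
  have hyr : ∀ h ∈ Set.Ici (0 : ℝ), y (z + h) = y z - ∫ t in (0 : ℝ)..h, g t := by
    intro h hh
    rcases (Set.mem_Ici.1 hh).eq_or_lt with rfl | hpos
    · simp
    have hzh : z + h ∈ openSector α :=
      add_mem_openSector h0 hα hz (ofReal_mem_openSector h0 hpos)
    have e1 : y z = ∫ t in Set.Ioi (0 : ℝ), g t := hT.smul_mul_laplaceResolvent h0 hM hq hz s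
    have e2 : y (z + h) = ∫ t in Set.Ioi h, g t := by
      have := setIntegral_Ioi_comp_add_right g 0 h
      rw [zero_add] at this
      rw [← this, hy]
      simp only
      rw [hT.smul_mul_laplaceResolvent h0 hM hq hzh s]
      refine setIntegral_congr_fun measurableSet_Ioi fun t _ => ?_
      simp only [hg]
      rw [show z + ((t + h : ℝ) : ℂ) = z + h + t by push_cast; ring]
    rw [e1, e2, ← intervalIntegral.integral_Ioi_sub_Ioi hgi hpos.le]
    abel
  have hd1 : HasDerivWithinAt (fun h : ℝ => y (z + h)) (deriv y z) (Set.Ici 0) 0 := by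
    have h1 : HasDerivAt (fun h : ℝ => z + (h : ℂ)) 1 0 :=
      Complex.ofRealCLM.hasDerivAt.const_add z
    have h2 : HasDerivAt y (deriv y z) (z + ((0 : ℝ) : ℂ)) := by simpa using hyd.hasDerivAt
    simpa [Function.comp_def] using (h2.scomp (0 : ℝ) h1).hasDerivWithinAt
  have hd2 : HasDerivWithinAt (fun h : ℝ => y (z + h)) (-(g 0)) (Set.Ici 0) 0 := by
    have h1 : HasDerivWithinAt (fun h => ∫ t in (0 : ℝ)..h, g t) (g 0) (Set.Ici 0) 0 :=
      intervalIntegral.integral_hasDerivWithinAt_right (t := Set.Ioi 0) (by simp)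
        ((hgc.mono Set.Ioi_subset_Ici_self).stronglyMeasurableAtFilter_nhdsWithin
          measurableSet_Ioi 0)
        ((hgc 0 Set.self_mem_Ici).mono Set.Ioi_subset_Ici_self)
    exact (h1.const_sub (y z)).congr hyr (hyr 0 Set.self_mem_Ici)
  have huniq : deriv y z = -(g 0) :=
    (uniqueDiffWithinAt_Ici (0 : ℝ)).eq_deriv _ hd1 hd2
  have := hyd.hasDerivAt
  rw [huniq] at this
  simpa [hg] using this

/-- No continuity of T at 0 is assumed. Multiplication by the Laplace integral only translates its
integrand, so dominated convergence applies. -/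
theorem IsAlgAnalyticSemigroup.tendsto_smul_mul_laplaceResolvent (hT : IsAlgAnalyticSemigroup α T)
    (h0 : 0 < α) (hα : α < Real.pi / 2) (hM : ∀ t ∈ openSector α, ‖T t‖ ≤ M)
    (hq : spectralRadius ℂ (T 1) = 0) {z : ℂ} (hz : z ∈ openSector α) (s : ℂ) :
    Filter.Tendsto (fun ε : ℝ => Complex.exp (s * (ε * z)) • (T (ε * z) * laplaceResolvent T s))
      (nhdsWithin 0 (Set.Ioi 0)) (nhds (laplaceResolvent T s)) := by
  have hM0 : 0 ≤ M := (norm_nonneg _).trans (hM z hz)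
  have hev : ∀ᶠ ε : ℝ in nhdsWithin 0 (Set.Ioi 0), 0 < ε ∧ ε < 1 :=
    Ioo_mem_nhdsGT one_pos
  have key : Filter.Tendsto (fun ε : ℝ => ∫ t in Set.Ioi (0 : ℝ),
      Complex.exp (s * (ε * z + t)) • T (ε * z + t)) (nhdsWithin 0 (Set.Ioi 0))
      (nhds (laplaceResolvent T s)) := by
    refine tendsto_integral_filter_of_dominated_convergence
      (fun t => Real.exp (‖s‖ * ‖z‖) * M * ‖Complex.exp (s * t) • T t‖) ?_ ?_ ?_ ?_
    · filter_upwards [hev] with ε hε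
      exact (hT.integrableOn_laplace_add h0 hM hq (real_mul_mem_openSector hε.1 hz) s).1
    · filter_upwards [hev] with ε hε
      refine (ae_restrict_mem measurableSet_Ioi).mono fun t ht => ?_
      have hεz := real_mul_mem_openSector hε.1 hz
      rw [hT.map_add _ hεz t (ofReal_mem_openSector h0 ht), mul_add, Complex.exp_add, mul_smul,
        norm_smul, ← mul_smul_comm]
      have h1 : ‖Complex.exp (s * (ε * z))‖ ≤ Real.exp (‖s‖ * ‖z‖) := by
        rw [Complex.norm_exp, Real.exp_le_exp]
        refine (Complex.re_le_norm _).trans ?_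
        rw [norm_mul, norm_mul, Complex.norm_real, Real.norm_of_nonneg hε.1.le]
        gcongr
        exact mul_le_of_le_one_left (norm_nonneg z) hε.2.le
      rw [mul_assoc]
      refine mul_le_mul h1 ((norm_mul_le _ _).trans ?_) (norm_nonneg _) (Real.exp_pos _).le
      gcongr
      exact hM _ hεz
    · exact ((hT.integrableOn_laplace h0 hM hq s).norm).const_mul _
    · refine (ae_restrict_mem measurableSet_Ioi).mono fun t ht => ?_
      have hc : ContinuousAt (fun w : ℂ => Complex.exp (s * w) • T w) t :=
        ContinuousAt.smul (f := fun w : ℂ => Complex.exp (s * w)) (by fun_prop) (hT.analytic.continuousOn.continuousAt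
          ((isOpen_openSector h0 hα).mem_nhds (ofReal_mem_openSector h0 ht)))
      have h2 : Filter.Tendsto (fun ε : ℝ => (ε : ℂ) * z + t) (nhdsWithin 0 (Set.Ioi 0))
          (nhds (t : ℂ)) := by
        have : ContinuousAt (fun ε : ℝ => (ε : ℂ) * z + t) 0 := by fun_prop
        have h3 := this.tendsto
        simp only [Complex.ofReal_zero, zero_mul, zero_add] at h3
        exact h3.mono_left nhdsWithin_le_nhds
      exact hc.tendsto.comp h2
  refine key.congr' ?_
  filter_upwards [hev] with ε hε
  exact (hT.smul_mul_laplaceResolvent h0 hM hq (real_mul_mem_openSector hε.1 hz) s).symm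

omit [CompleteSpace A] in
theorem IsAlgAnalyticSemigroup.continuousOn_ray (hT : IsAlgAnalyticSemigroup α T) {z : ℂ}
    (hz : z ∈ openSector α) (s : ℂ) :
    ContinuousOn (fun τ : ℝ => z • (Complex.exp (s * (τ * z)) • T (τ * z))) (Set.Ioi 0) := by
  have h1 : ContinuousOn (fun τ : ℝ => Complex.exp (s * (τ * z))) (Set.Ioi 0) := by fun_prop
  have h2 : ContinuousOn (fun τ : ℝ => (τ : ℂ) * z) (Set.Ioi 0) := by fun_prop
  exact (h1.smul (hT.analytic.continuousOn.comp h2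
    fun _ hτ => real_mul_mem_openSector hτ hz)).const_smul z

/-- The derivative formula is integrated along the segment from 0 to z, with the limit at 0 as
boundary value. This moves the Laplace integral from the positive axis to any ray of the sector. -/
theorem IsAlgAnalyticSemigroup.laplaceResolvent_sub (hT : IsAlgAnalyticSemigroup α T)
    (h0 : 0 < α) (hα : α < Real.pi / 2) (hM : ∀ t ∈ openSector α, ‖T t‖ ≤ M)
    (hq : spectralRadius ℂ (T 1) = 0) {z : ℂ} (hz : z ∈ openSector α) (s : ℂ) :
    laplaceResolvent T s - Complex.exp (s * z) • (T z * laplaceResolvent T s) =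
      ∫ τ in (0 : ℝ)..1, z • (Complex.exp (s * (τ * z)) • T (τ * z)) := by
  have hd : ∀ τ : ℝ, 0 < τ → HasDerivAt
      (fun τ : ℝ => Complex.exp (s * (τ * z)) • (T (τ * z) * laplaceResolvent T s))
      (-(z • (Complex.exp (s * (τ * z)) • T (τ * z)))) τ := by
    intro τ hτ
    have h1 : HasDerivAt (fun τ : ℝ => (τ : ℂ) * z) z τ := by
      simpa using Complex.ofRealCLM.hasDerivAt.mul_const z
    have h2 := hT.hasDerivAt_smul_mul_laplaceResolvent h0 hα hM hq
      (real_mul_mem_openSector hτ hz) s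
    simpa [Function.comp_def] using h2.scomp τ h1
  have hint : IntervalIntegrable (fun τ : ℝ => z • (Complex.exp (s * (τ * z)) • T (τ * z)))
      volume 0 1 := by
    rw [intervalIntegrable_iff_integrableOn_Ioc_of_le zero_le_one]
    refine Integrable.mono' (g := fun _ => ‖z‖ * (Real.exp (‖s‖ * ‖z‖) * M))
      (integrableOn_const (by simp))
      (((hT.continuousOn_ray hz s).mono Set.Ioc_subset_Ioi_self).aestronglyMeasurable
        measurableSet_Ioc) ?_
    refine (ae_restrict_mem measurableSet_Ioc).mono fun τ hτ => ?_
    rw [norm_smul, norm_smul]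
    gcongr
    · rw [Complex.norm_exp, Real.exp_le_exp]
      refine (Complex.re_le_norm _).trans ?_
      rw [norm_mul, norm_mul, Complex.norm_real, Real.norm_of_nonneg hτ.1.le]
      gcongr
      exact mul_le_of_le_one_left (norm_nonneg z) hτ.2
    · exact hM _ (real_mul_mem_openSector hτ.1 hz)
  have h1 := intervalIntegral.integral_eq_sub_of_hasDerivAt_of_tendsto zero_lt_one
    (fun τ hτ => hd τ hτ.1) hint.neg
    (hT.tendsto_smul_mul_laplaceResolvent h0 hα hM hq hz s)
    ((hd 1 one_pos).continuousAt.tendsto.mono_left nhdsWithin_le_nhds)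
  rw [intervalIntegral.integral_neg, neg_eq_iff_eq_neg] at h1
  rw [h1]
  simp

/-- If it vanished at s, the derivative formula would read 0 = -e^{st} T(t) for every t in the
sector. -/
theorem IsAlgAnalyticSemigroup.laplaceResolvent_ne_zero (hT : IsAlgAnalyticSemigroup α T)
    (h0 : 0 < α) (hα : α < Real.pi / 2) (hM : ∀ t ∈ openSector α, ‖T t‖ ≤ M)
    (hq : spectralRadius ℂ (T 1) = 0) (hne : ∃ t ∈ openSector α, T t ≠ 0) (s : ℂ) :
    laplaceResolvent T s ≠ 0 := by
  intro hL
  obtain ⟨t, ht, htne⟩ := hne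
  have h1 := hT.hasDerivAt_smul_mul_laplaceResolvent h0 hα hM hq ht s
  rw [hL] at h1
  simp only [mul_zero, smul_zero] at h1
  have h2 := h1.unique (hasDerivAt_const t _)
  rw [neg_eq_zero, smul_eq_zero] at h2
  exact htne (h2.resolve_left (Complex.exp_ne_zero _))

end Semigroup

/-! ### Two bounds for the resolvent -/

section ResolventBounds

variable {A : Type*} [NormedRing A] [NormedAlgebra ℂ A] [CompleteSpace A] {α M : ℝ} {T : ℂ → A}

theorem IsAlgAnalyticSemigroup.norm_laplaceResolvent_sub_le (hT : IsAlgAnalyticSemigroup α T)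
    (h0 : 0 < α) (hα : α < Real.pi / 2) (hM : ∀ t ∈ openSector α, ‖T t‖ ≤ M)
    (hq : spectralRadius ℂ (T 1) = 0) {z : ℂ} (hz : z ∈ openSector α) (s : ℂ) :
    ‖laplaceResolvent T s - Complex.exp (s * z) • (T z * laplaceResolvent T s)‖ ≤
      ‖z‖ * M * ∫ τ in (0 : ℝ)..1, Real.exp ((s * z).re * τ) := by
  rw [hT.laplaceResolvent_sub h0 hα hM hq hz s, ← intervalIntegral.integral_const_mul]
  refine intervalIntegral.norm_integral_le_of_norm_le zero_le_one ?_
    (Continuous.intervalIntegrable (by fun_prop) _ _)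
  refine Filter.Eventually.of_forall fun τ hτ => ?_
  rw [norm_smul, norm_smul, Complex.norm_exp, mul_assoc, mul_comm M]
  have h1 : (s * (τ * z)).re = (s * z).re * τ := by
    rw [show s * (τ * z) = s * z * τ by ring, Complex.re_mul_ofReal]
  rw [h1]
  gcongr
  exact hM _ (real_mul_mem_openSector hτ.1 hz)

theorem IsAlgAnalyticSemigroup.norm_laplaceResolvent_sub_le_exp
    (hT : IsAlgAnalyticSemigroup α T)
    (h0 : 0 < α) (hα : α < Real.pi / 2) (hM : ∀ t ∈ openSector α, ‖T t‖ ≤ M)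
    (hq : spectralRadius ℂ (T 1) = 0) {z : ℂ} (hz : z ∈ openSector α) (s : ℂ) :
    ‖laplaceResolvent T s - Complex.exp (s * z) • (T z * laplaceResolvent T s)‖ ≤
      ‖z‖ * M * Real.exp ‖s * z‖ := by
  refine (hT.norm_laplaceResolvent_sub_le h0 hα hM hq hz s).trans ?_
  have hM0 : 0 ≤ M := (norm_nonneg _).trans (hM z hz)
  gcongr
  calc _ ≤ ∫ τ in (0 : ℝ)..1, Real.exp ‖s * z‖ := by
        refine intervalIntegral.integral_mono_on zero_le_one
          (Continuous.intervalIntegrable (by fun_prop) _ _)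
          (Continuous.intervalIntegrable (by fun_prop) _ _) fun τ hτ => ?_
        rw [Real.exp_le_exp]
        calc _ ≤ ‖s * z‖ * τ := mul_le_mul_of_nonneg_right (Complex.re_le_norm _) hτ.1
          _ ≤ _ := mul_le_of_le_one_right (norm_nonneg _) hτ.2
    _ = _ := by simp

/-- The segment identity is applied at rz. As r → ∞ the term e^{srz} T(rz) L(s) dies out, while the
integral stays below its value over the whole ray. -/
theorem IsAlgAnalyticSemigroup.norm_laplaceResolvent_le (hT : IsAlgAnalyticSemigroup α T)
    (h0 : 0 < α) (hα : α < Real.pi / 2) (hM : ∀ t ∈ openSector α, ‖T t‖ ≤ M)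
    (hq : spectralRadius ℂ (T 1) = 0) {z : ℂ} (hz : z ∈ openSector α) {s : ℂ}
    (hsz : (s * z).re < 0) : ‖laplaceResolvent T s‖ ≤ ‖z‖ * M / (-(s * z).re) := by
  set c : ℝ := (s * z).re with hc
  have hM0 : 0 ≤ M := (norm_nonneg _).trans (hM z hz)
  set L : A := laplaceResolvent T s
  have hbound : ∀ r : ℝ, 0 < r → ‖L‖ ≤ ‖z‖ * M / (-c) + Real.exp (c * r) * (M * ‖L‖) := by
    intro r hr
    have hrz := real_mul_mem_openSector hr hz
    have hre : (s * (r * z)).re = c * r := by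
      rw [show s * (r * z) = s * z * r by ring, Complex.re_mul_ofReal]
    have h1 := hT.norm_laplaceResolvent_sub_le h0 hα hM hq hrz s
    rw [hre] at h1
    have hint : ∫ τ in (0 : ℝ)..1, Real.exp (c * r * τ) = (Real.exp (c * r) - 1) / (c * r) := by
      have hcr : c * r ≠ 0 := (mul_neg_of_neg_of_pos hsz hr).ne
      rw [intervalIntegral.integral_comp_mul_left (fun x => Real.exp x) hcr]
      simp [div_eq_inv_mul]
    have h2 : ‖(r : ℂ) * z‖ * M * ∫ τ in (0 : ℝ)..1, Real.exp (c * r * τ) ≤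
        ‖z‖ * M / (-c) := by
      rw [hint, norm_mul, Complex.norm_real, Real.norm_of_nonneg hr.le]
      have : r * ‖z‖ * M * ((Real.exp (c * r) - 1) / (c * r)) =
          ‖z‖ * M * (1 - Real.exp (c * r)) / (-c) := by
        have : c ≠ 0 := hsz.ne
        field_simp
        ring
      rw [this]
      have hc' : 0 < -c := neg_pos.2 hsz
      exact div_le_div_of_nonneg_right (mul_le_of_le_one_right (mul_nonneg (norm_nonneg z) hM0)
        (by linarith [Real.exp_pos (c * r)])) hc'.le
    have h3 : ‖Complex.exp (s * (r * z)) • (T (r * z) * L)‖ ≤ Real.exp (c * r) * (M * ‖L‖) := by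
      rw [norm_smul, Complex.norm_exp, hre]
      gcongr
      exact (norm_mul_le _ _).trans (by gcongr; exact hM _ hrz)
    calc ‖L‖ ≤ ‖L - Complex.exp (s * (r * z)) • (T (r * z) * L)‖ +
          ‖Complex.exp (s * (r * z)) • (T (r * z) * L)‖ := norm_le_norm_sub_add _ _
      _ ≤ _ := add_le_add (h1.trans h2) h3
  have hlim : Filter.Tendsto (fun r : ℝ => ‖z‖ * M / (-c) + Real.exp (c * r) * (M * ‖L‖))
      Filter.atTop (nhds (‖z‖ * M / (-c) + 0 * (M * ‖L‖))) := by
    refine Filter.Tendsto.const_add _ (Filter.Tendsto.mul_const _ ?_)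
    exact Real.tendsto_exp_atBot.comp (Filter.tendsto_id.const_mul_atTop_of_neg hsz)
  rw [zero_mul, add_zero] at hlim
  exact ge_of_tendsto hlim ((Filter.eventually_gt_atTop 0).mono hbound)

variable {β : ℝ} {μ : ComplexMeasure ℂ} {K : Set ℂ}

omit [CompleteSpace A] in
theorem IsAlgAnalyticSemigroup.integrable_comp_mul (hT : IsAlgAnalyticSemigroup α T)
    (hα : α < Real.pi / 2) (hK : IsCompact K) (hKβ : K ⊆ closedSector β)
    (hμK : IsSupportedOn μ K) {u : ℂ} (hu : u ∈ openSector (α - β)) :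
    μ.Integrable fun ξ => T (u * ξ) :=
  hμK.integrable hK (hT.analytic.continuousOn.comp (by fun_prop)
    fun _ hξ => mul_mem_openSector hα hu (hKβ hξ))

/-- The segment identity at s = z/u and the point uξ has exponent zξ, free of u; the factor |u| is
the length of the segment. One e^{|z|R} comes from e^{-zξ}, the other from the integral. -/
theorem IsAlgAnalyticSemigroup.norm_fourierBorel_smul_sub_le (hT : IsAlgAnalyticSemigroup α T)
    (h0 : 0 < α) (hα : α < Real.pi / 2) (hM : ∀ t ∈ openSector α, ‖T t‖ ≤ M)
    (hq : spectralRadius ℂ (T 1) = 0) (hK : IsCompact K) (hKβ : K ⊆ closedSector β)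
    (hμK : IsSupportedOn μ K) {R : ℝ} (hR : ∀ ξ ∈ K, ‖ξ‖ ≤ R) {u : ℂ}
    (hu : u ∈ openSector (α - β)) (z : ℂ) :
    ‖fourierBorel μ z • laplaceResolvent T (z / u) -
      complexIntegral μ (fun ξ => T (u * ξ)) * laplaceResolvent T (z / u)‖ ≤
      ‖u‖ * (R * M * Real.exp (2 * (‖z‖ * R)) * μ.variation.real Set.univ) := by
  have hu0 : u ≠ 0 := fun h => by simpa [h] using hu.1
  have hM0 : 0 ≤ M := (norm_nonneg _).trans (hM _ (ofReal_mem_openSector h0 one_pos))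
  set L : A := laplaceResolvent T (z / u) with hL
  have hi1 : μ.Integrable fun ξ => Complex.exp (-z * ξ) := hμK.integrable_exp hK z
  have hi2 := hT.integrable_comp_mul hα hK hKβ hμK hu
  have e1 : fourierBorel μ z • L = complexIntegral μ fun ξ => Complex.exp (-z * ξ) • L :=
    ((ContinuousLinearMap.toSpanSingleton ℂ L).complexIntegral_comp_comm hi1).symm
  have e2 : complexIntegral μ (fun ξ => T (u * ξ)) * L =
      complexIntegral μ fun ξ => T (u * ξ) * L :=
    (((ContinuousLinearMap.mul ℂ A).flip L).complexIntegral_comp_comm hi2).symm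
  have hi1' : μ.Integrable fun ξ => Complex.exp (-z * ξ) • L :=
    (ContinuousLinearMap.toSpanSingleton ℂ L).integrable_comp hi1
  have hi2' : μ.Integrable fun ξ => T (u * ξ) * L :=
    ((ContinuousLinearMap.mul ℂ A).flip L).integrable_comp hi2
  rw [e1, e2, ← complexIntegral_sub hi1' hi2', ← mul_assoc]
  refine hμK.norm_complexIntegral_le hK.measurableSet fun ξ hξ => ?_
  have hξu := mul_mem_openSector hα hu (hKβ hξ)
  have hzξ : z / u * (u * ξ) = z * ξ := by field_simp
  have key := hT.norm_laplaceResolvent_sub_le_exp h0 hα hM hq hξu (z / u)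
  rw [hzξ] at key
  have hfac : Complex.exp (-z * ξ) • L - T (u * ξ) * L =
      Complex.exp (-z * ξ) • (L - Complex.exp (z * ξ) • (T (u * ξ) * L)) := by
    rw [smul_sub, smul_smul, ← Complex.exp_add]
    simp
  have hle : ‖z * ξ‖ ≤ ‖z‖ * R := by
    rw [norm_mul]
    gcongr
    exact hR ξ hξ
  rw [hfac, norm_smul, Complex.norm_exp]
  calc _ ≤ Real.exp (‖z‖ * R) * (‖u * ξ‖ * M * Real.exp (‖z‖ * R)) := by
        gcongr
        · refine (Complex.re_le_norm _).trans ?_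
          rwa [neg_mul, norm_neg]
        · exact key.trans (by gcongr)
    _ ≤ Real.exp (‖z‖ * R) * (‖u‖ * R * M * Real.exp (‖z‖ * R)) := by
        rw [norm_mul]
        gcongr
        exact hR ξ hξ
    _ = _ := by rw [two_mul, Real.exp_add]; ring

theorem IsAlgAnalyticSemigroup.sub_mul_norm_laplaceResolvent_le
    (hT : IsAlgAnalyticSemigroup α T)
    (h0 : 0 < α) (hα : α < Real.pi / 2) (hM : ∀ t ∈ openSector α, ‖T t‖ ≤ M)
    (hq : spectralRadius ℂ (T 1) = 0) (hK : IsCompact K) (hKβ : K ⊆ closedSector β)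
    (hμK : IsSupportedOn μ K) {R : ℝ} (hR : ∀ ξ ∈ K, ‖ξ‖ ≤ R) {u : ℂ}
    (hu : u ∈ openSector (α - β)) (z : ℂ) {m : ℝ}
    (hm : ‖complexIntegral μ (fun ξ => T (u * ξ))‖ ≤ m) :
    (‖fourierBorel μ z‖ - m) * ‖laplaceResolvent T (z / u)‖ ≤
      ‖u‖ * (R * M * Real.exp (2 * (‖z‖ * R)) * μ.variation.real Set.univ) := by
  refine le_trans ?_ (hT.norm_fourierBorel_smul_sub_le h0 hα hM hq hK hKβ hμK hR hu z)
  refine le_trans ?_ (norm_sub_norm_le _ _)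
  rw [sub_mul, norm_smul]
  gcongr
  exact (norm_mul_le _ _).trans (by gcongr)

end ResolventBounds

/-! ### Cauchy's formula on a symmetric polygon -/

section PolygonalIntegral

variable {E : Type*} [NormedAddCommGroup E] [NormedSpace ℂ E]

/-- The integral of `f` along the segment from `a` to `b`. -/
noncomputable def segmentIntegral (f : ℂ → E) (a b : ℂ) : E :=
  ∫ t in (0 : ℝ)..1, (b - a) • f (AffineMap.lineMap a b t)

/-- The polygonal chain through the points `v 0, …, v n`. -/
def polygonalChain (v : ℕ → ℂ) (n : ℕ) : Set ℂ :=
  ⋃ i ∈ Finset.range n, segment ℝ (v i) (v (i + 1))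

/-- The integral of `f` along the polygonal chain through the points `v 0, …, v n`. -/
noncomputable def polygonalIntegral (f : ℂ → E) (v : ℕ → ℂ) (n : ℕ) : E :=
  ∑ i ∈ Finset.range n, segmentIntegral f (v i) (v (i + 1))

theorem lineMap_mem_segment_of_mem_uIcc {a b : ℂ} {t : ℝ} (ht : t ∈ Set.uIcc (0 : ℝ) 1) :
    AffineMap.lineMap a b t ∈ segment ℝ a b := by
  rw [segment_eq_image_lineMap]
  rw [Set.uIcc_of_le zero_le_one] at ht
  exact ⟨t, ht, rfl⟩

theorem continuousOn_comp_lineMap {f : ℂ → E} {a b : ℂ} (hf : ContinuousOn f (segment ℝ a b)) :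
    ContinuousOn (fun t : ℝ => (b - a) • f (AffineMap.lineMap a b t)) (Set.uIcc 0 1) :=
  (hf.comp (AffineMap.lineMap_continuous (R := ℝ)).continuousOn
    fun _ ht => lineMap_mem_segment_of_mem_uIcc ht).const_smul _

theorem segmentIntegral_add {f g : ℂ → E} {a b : ℂ} (hf : ContinuousOn f (segment ℝ a b))
    (hg : ContinuousOn g (segment ℝ a b)) :
    segmentIntegral (fun x => f x + g x) a b = segmentIntegral f a b + segmentIntegral g a b := by
  simp only [segmentIntegral, smul_add]
  exact intervalIntegral.integral_add (continuousOn_comp_lineMap hf).intervalIntegrable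
    (continuousOn_comp_lineMap hg).intervalIntegrable

theorem segmentIntegral_smul_const [CompleteSpace E] (f : ℂ → ℂ) (c : E) (a b : ℂ) :
    segmentIntegral (fun x => f x • c) a b = segmentIntegral f a b • c := by
  simp only [segmentIntegral, smul_smul, ← intervalIntegral.integral_smul_const, smul_eq_mul]

theorem norm_segmentIntegral_le {f : ℂ → E} {a b : ℂ} {C : ℝ}
    (hC : ∀ x ∈ segment ℝ a b, ‖f x‖ ≤ C) : ‖segmentIntegral f a b‖ ≤ ‖b - a‖ * C := by
  have := intervalIntegral.norm_integral_le_of_norm_le_const (a := (0 : ℝ)) (b := 1)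
    (f := fun t : ℝ => (b - a) • f (AffineMap.lineMap a b t)) (C := ‖b - a‖ * C) fun t ht => by
      rw [norm_smul]
      gcongr
      exact hC _ (lineMap_mem_segment_of_mem_uIcc (Set.uIoc_subset_uIcc ht))
  rw [segmentIntegral]
  rwa [sub_zero, abs_one, mul_one] at this

theorem segmentIntegral_eq_sub [CompleteSpace E] {f Φ : ℂ → E} {a b : ℂ}
    (hf : ContinuousOn f (segment ℝ a b))
    (hΦ : ∀ x ∈ segment ℝ a b, HasDerivAt Φ (f x) x) :
    segmentIntegral f a b = Φ b - Φ a := by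
  have h := intervalIntegral.integral_eq_sub_of_hasDerivAt (a := (0 : ℝ)) (b := 1)
    (f := fun t : ℝ => Φ (AffineMap.lineMap a b t))
    (f' := fun t : ℝ => (b - a) • f (AffineMap.lineMap a b t)) (fun t ht => ?_)
    (continuousOn_comp_lineMap hf).intervalIntegrable
  · simpa [segmentIntegral] using h
  · have h1 : HasDerivAt (fun t : ℝ => (AffineMap.lineMap a b t : ℂ)) (b - a) t :=
      AffineMap.hasDerivAt_lineMap
    exact (hΦ _ (lineMap_mem_segment_of_mem_uIcc ht)).scomp t h1

theorem segment_subset_polygonalChain (v : ℕ → ℂ) {n i : ℕ} (hi : i ∈ Finset.range n) :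
    segment ℝ (v i) (v (i + 1)) ⊆ polygonalChain v n :=
  Set.subset_biUnion_of_mem (u := fun i => segment ℝ (v i) (v (i + 1))) (Finset.mem_coe.2 hi)

theorem mem_polygonalChain {v : ℕ → ℂ} {n : ℕ} {x : ℂ} :
    x ∈ polygonalChain v n ↔ ∃ i < n, x ∈ segment ℝ (v i) (v (i + 1)) := by
  simp [polygonalChain]

theorem isCompact_polygonalChain (v : ℕ → ℂ) (n : ℕ) : IsCompact (polygonalChain v n) := by
  refine Finset.isCompact_biUnion _ fun i _ => ?_
  rw [segment_eq_image_lineMap]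
  exact isCompact_Icc.image (AffineMap.lineMap_continuous (R := ℝ))

theorem conj_mem_polygonalChain {v : ℕ → ℂ} {n : ℕ} {x : ℂ}
    (hx : x ∈ polygonalChain (fun i => (starRingEnd ℂ) (v i)) n) :
    (starRingEnd ℂ) x ∈ polygonalChain v n := by
  rw [mem_polygonalChain] at hx ⊢
  obtain ⟨i, hi, a, b, ha, hb, hab, rfl⟩ := hx
  exact ⟨i, hi, a, b, ha, hb, hab, by simp⟩

variable {v : ℕ → ℂ} {n : ℕ}

theorem polygonalIntegral_add {f g : ℂ → E} (hf : ContinuousOn f (polygonalChain v n))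
    (hg : ContinuousOn g (polygonalChain v n)) :
    polygonalIntegral (fun x => f x + g x) v n =
      polygonalIntegral f v n + polygonalIntegral g v n := by
  rw [polygonalIntegral, polygonalIntegral, polygonalIntegral, ← Finset.sum_add_distrib]
  exact Finset.sum_congr rfl fun i hi => segmentIntegral_add
    (hf.mono (segment_subset_polygonalChain v hi)) (hg.mono (segment_subset_polygonalChain v hi))

theorem polygonalIntegral_congr {f g : ℂ → E} (h : Set.EqOn f g (polygonalChain v n)) :
    polygonalIntegral f v n = polygonalIntegral g v n := by
  refine Finset.sum_congr rfl fun i hi => ?_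
  refine intervalIntegral.integral_congr fun t ht => ?_
  rw [h (segment_subset_polygonalChain v hi (lineMap_mem_segment_of_mem_uIcc ht))]

theorem polygonalIntegral_smul_const [CompleteSpace E] (f : ℂ → ℂ) (c : E) :
    polygonalIntegral (fun x => f x • c) v n = polygonalIntegral f v n • c := by
  simp only [polygonalIntegral, segmentIntegral_smul_const, Finset.sum_smul]

theorem norm_polygonalIntegral_le {f : ℂ → E} {C : ℝ}
    (hC : ∀ x ∈ polygonalChain v n, ‖f x‖ ≤ C) :
    ‖polygonalIntegral f v n‖ ≤ (∑ i ∈ Finset.range n, ‖v (i + 1) - v i‖) * C := by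
  rw [Finset.sum_mul]
  exact norm_sum_le_of_le _ fun i hi =>
    norm_segmentIntegral_le fun x hx => hC x (segment_subset_polygonalChain v hi hx)

theorem polygonalIntegral_eq_sub [CompleteSpace E] {f Φ : ℂ → E}
    (hf : ContinuousOn f (polygonalChain v n))
    (hΦ : ∀ x ∈ polygonalChain v n, HasDerivAt Φ (f x) x) :
    polygonalIntegral f v n = Φ (v n) - Φ (v 0) := by
  rw [← Finset.sum_range_sub (fun i => Φ (v i))]
  exact Finset.sum_congr rfl fun i hi =>
    segmentIntegral_eq_sub (hf.mono (segment_subset_polygonalChain v hi))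
      fun x hx => hΦ x (segment_subset_polygonalChain v hi hx)

theorem continuousOn_inv_sub {s : Set ℂ} {z : ℂ} (hz : z ∉ s) :
    ContinuousOn (fun x => (x - z)⁻¹) s :=
  ContinuousOn.inv₀ (by fun_prop) fun x hx h => hz (by rwa [← sub_eq_zero.1 h])

/-- The integral of `(ζ - z)⁻¹` along a chain in a half plane, through a rotated logarithm. -/
theorem polygonalIntegral_inv_sub_eq_log {c z : ℂ} (hc : c ≠ 0)
    (hslit : ∀ x ∈ polygonalChain v n, c * (x - z) ∈ Complex.slitPlane) :
    polygonalIntegral (fun x => (x - z)⁻¹) v n =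
      Complex.log (c * (v n - z)) - Complex.log (c * (v 0 - z)) := by
  have hne : ∀ x ∈ polygonalChain v n, x - z ≠ 0 := fun x hx h => by
    have := Complex.slitPlane_ne_zero (hslit x hx)
    simp [h] at this
  refine polygonalIntegral_eq_sub (Φ := fun x => Complex.log (c * (x - z)))
    (continuousOn_inv_sub fun h => hne z h (sub_self z)) fun x hx => ?_
  have h1 : HasDerivAt (fun x => c * (x - z)) c x := by
    simpa using ((hasDerivAt_id x).sub_const z).const_mul c
  have h2 := h1.clog (hslit x hx)
  rwa [div_mul_cancel_left₀ hc] at h2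

/-- The integral of `(ζ - z)⁻¹ - (ζ - z')⁻¹` when the chain misses the segment from `z` to `z'`. -/
theorem polygonalIntegral_inv_sub_eq_add_log {z z' : ℂ}
    (hdisj : ∀ x ∈ polygonalChain v n, x ∉ segment ℝ z z') :
    polygonalIntegral (fun x => (x - z)⁻¹) v n =
      polygonalIntegral (fun x => (x - z')⁻¹) v n +
        (Complex.log ((v n - z) / (v n - z')) - Complex.log ((v 0 - z) / (v 0 - z'))) := by
  have hz : z ∉ polygonalChain v n := fun h => hdisj z h (left_mem_segment ℝ z z')
  have hz' : z' ∉ polygonalChain v n := fun h => hdisj z' h (right_mem_segment ℝ z z')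
  have hc := continuousOn_inv_sub hz
  have hc' := continuousOn_inv_sub hz'
  have key : polygonalIntegral (fun x => (x - z)⁻¹ - (x - z')⁻¹) v n =
      Complex.log ((v n - z) / (v n - z')) - Complex.log ((v 0 - z) / (v 0 - z')) := by
    refine polygonalIntegral_eq_sub (Φ := fun x => Complex.log ((x - z) / (x - z')))
      (hc.sub hc') fun x hx => ?_
    have hxz : x - z ≠ 0 := fun h => hz (by rwa [← sub_eq_zero.1 h])
    have hxz' : x - z' ≠ 0 := fun h => hz' (by rwa [← sub_eq_zero.1 h])
    -- If the quotient were -r with r ≥ 0, then x = (z + r z') / (1 + r) would lie on the segment.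
    have hslit : (x - z) / (x - z') ∈ Complex.slitPlane := by
      rw [Complex.mem_slitPlane_iff_not_le_zero]
      intro hle
      obtain ⟨r, hr, hr'⟩ : ∃ r : ℝ, 0 ≤ r ∧ (x - z) / (x - z') = -(r : ℂ) := by
        refine ⟨-((x - z) / (x - z')).re, ?_, ?_⟩
        · simpa using (Complex.le_def.1 hle).1
        · apply Complex.ext
          · simp
          · simpa using (Complex.le_def.1 hle).2
      rw [div_eq_iff hxz'] at hr'
      have hr1 : (1 + r : ℂ) ≠ 0 := by
        have : (1 + r : ℝ) ≠ 0 := by positivity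
        exact_mod_cast this
      refine hdisj x hx ⟨1 / (1 + r), r / (1 + r), by positivity, by positivity, ?_, ?_⟩
      · field_simp
      · rw [Complex.real_smul, Complex.real_smul]
        push_cast
        field_simp
        linear_combination -hr'
    have h1 : HasDerivAt (fun x => (x - z) / (x - z'))
        ((1 * (x - z') - (x - z) * 1) / (x - z') ^ 2) x :=
      ((hasDerivAt_id x).sub_const z).div ((hasDerivAt_id x).sub_const z') hxz'
    have h2 := h1.clog hslit
    have h3 : (1 * (x - z') - (x - z) * 1) / (x - z') ^ 2 / ((x - z) / (x - z')) =
        (x - z)⁻¹ - (x - z')⁻¹ := by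
      field_simp
    rwa [h3] at h2
  have hadd := polygonalIntegral_add (g := fun x => (x - z)⁻¹ - (x - z')⁻¹) hc' (hc.sub hc')
  rw [← key, ← hadd]
  simp

/-- Splitting f = f(z) + (x - z) `dslope f z x` leaves a part with an entire primitive, which
depends on the endpoints only and cancels between two chains with common ends. -/
theorem polygonalIntegral_inv_sub_smul [CompleteSpace E] {f : ℂ → E} (hf : Differentiable ℂ f)
    {Φ : ℂ → E} {z : ℂ} (hΦ : ∀ x, HasDerivAt Φ (dslope f z x) x)
    (hz : z ∉ polygonalChain v n) :
    polygonalIntegral (fun x => (x - z)⁻¹ • f x) v n =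
      (Φ (v n) - Φ (v 0)) + polygonalIntegral (fun x => (x - z)⁻¹) v n • f z := by
  have hd : Differentiable ℂ (dslope f z) := by
    rw [← differentiableOn_univ, Complex.differentiableOn_dslope Filter.univ_mem]
    exact hf.differentiableOn
  have hc := continuousOn_inv_sub hz
  rw [← polygonalIntegral_smul_const, ← polygonalIntegral_eq_sub hd.continuous.continuousOn
    fun x _ => hΦ x, ← polygonalIntegral_add (g := fun x => (x - z)⁻¹ • f z)
      hd.continuous.continuousOn (hc.smul continuousOn_const)]
  refine polygonalIntegral_congr fun x hx => ?_
  have hxz : x ≠ z := fun h => hz (by rwa [← h])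
  rw [dslope_of_ne _ hxz, slope_def_module, ← smul_add, sub_add_cancel]

/-- Cauchy estimate for a closed polygon that consists of a chain in the upper half plane from
`b > 0` to `0` and its mirror image. -/
theorem norm_le_of_polygonalChain [CompleteSpace E] {b x : ℝ} (hv0 : v 0 = b) (hvn : v n = 0)
    (him : ∀ y ∈ polygonalChain v n, 0 ≤ y.im) {S : Set ℂ} (hS : Convex ℝ S)
    (hdisj : ∀ y ∈ polygonalChain v n, y ∉ S ∧ (starRingEnd ℂ) y ∉ S)
    (hx0 : 0 < x) (hxb : x < b) (hxS : (x : ℂ) ∈ S) {z : ℂ} (hz : z ∈ S) {f : ℂ → E}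
    (hf : Differentiable ℂ f) {B d : ℝ} (hd0 : 0 < d)
    (hd : ∀ y ∈ polygonalChain v n, d ≤ ‖y - z‖ ∧ d ≤ ‖(starRingEnd ℂ) y - z‖)
    (hB : ∀ y ∈ polygonalChain v n, ‖f y‖ ≤ B ∧ ‖f ((starRingEnd ℂ) y)‖ ≤ B) :
    2 * Real.pi * ‖f z‖ ≤ 2 * (∑ i ∈ Finset.range n, ‖v (i + 1) - v i‖) * (d⁻¹ * B) := by
  set v' : ℕ → ℂ := fun i => (starRingEnd ℂ) (v i) with hv'
  have hv0' : v' 0 = b := by simp [hv', hv0]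
  have hvn' : v' n = 0 := by simp [hv', hvn]
  have hconj : ∀ y ∈ polygonalChain v' n, (starRingEnd ℂ) y ∈ polygonalChain v n :=
    fun y hy => conj_mem_polygonalChain hy
  have hdisj' : ∀ y ∈ polygonalChain v' n, y ∉ S := fun y hy => by
    simpa using (hdisj _ (hconj y hy)).2
  obtain ⟨Φ, hΦ⟩ : ∃ Φ : ℂ → E, ∀ y, HasDerivAt Φ (dslope f z y) y := by
    have hds : Differentiable ℂ (dslope f z) := by
      rw [← differentiableOn_univ, Complex.differentiableOn_dslope Filter.univ_mem]
      exact hf.differentiableOn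
    obtain ⟨Φ, hΦ⟩ := hds.isExactOn_univ
    exact ⟨Φ, fun y => hΦ y (Set.mem_univ y)⟩
  have hI : Complex.I ≠ 0 := Complex.I_ne_zero
  -- The rotation by -i puts the cut of the logarithm below x, away from the upper chain; the lower
  -- chain uses i.
  have hup := polygonalIntegral_inv_sub_eq_log (v := v) (n := n) (c := -Complex.I) (z := (x : ℂ))
    (neg_ne_zero.2 hI) fun y hy => by
      have hne : y ≠ x := fun h => (hdisj y hy).1 (h ▸ hxS)
      rw [Complex.mem_slitPlane_iff]
      rcases (him y hy).eq_or_lt with h | h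
      · right
        intro h0
        refine hne (Complex.ext ?_ ?_)
        · simp at h0; simp; linarith
        · simp [← h]
      · left; simpa using h
  have hlow := polygonalIntegral_inv_sub_eq_log (v := v') (n := n) (c := Complex.I) (z := (x : ℂ))
    hI fun y hy => by
      have hne : y ≠ x := fun h => hdisj' y hy (h ▸ hxS)
      have him' := him _ (hconj y hy)
      rw [Complex.conj_im] at him'
      rw [Complex.mem_slitPlane_iff]
      rcases him'.eq_or_lt with h | h
      · right
        intro h0
        refine hne (Complex.ext ?_ ?_)
        · simp at h0; simp; linarith
        · simp; linarith
      · left; simpa using h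
  -- The winding number is computed at the real point x, where the logarithms are explicit, and
  -- carried to z along a segment in S; the correction terms cancel because the two chains share
  -- their ends.
  have hwind : polygonalIntegral (fun y => (y - z)⁻¹) v n -
      polygonalIntegral (fun y => (y - z)⁻¹) v' n = 2 * Real.pi * Complex.I := by
    have hseg : segment ℝ z (x : ℂ) ⊆ S := hS.segment_subset hz hxS
    rw [polygonalIntegral_inv_sub_eq_add_log (z' := (x : ℂ)) fun y hy h => (hdisj y hy).1 (hseg h),
      polygonalIntegral_inv_sub_eq_add_log (v := v') (z' := (x : ℂ))
        fun y hy h => hdisj' y hy (hseg h), hup, hlow, hv0, hvn, hv0', hvn']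
    have hbx : 0 < b - x := sub_pos.2 hxb
    have e1 : Complex.log (-Complex.I * (0 - x)) = Real.log x + Real.pi / 2 * Complex.I := by
      rw [show -Complex.I * (0 - (x : ℂ)) = x * Complex.I by ring,
        Complex.log_ofReal_mul hx0 hI, Complex.log_I]
    have e2 : Complex.log (-Complex.I * (b - x)) =
        Real.log (b - x) + -(Real.pi / 2) * Complex.I := by
      rw [show -Complex.I * ((b : ℂ) - (x : ℂ)) = ((b - x : ℝ) : ℂ) * (-Complex.I) by
        push_cast; ring, Complex.log_ofReal_mul hbx (neg_ne_zero.2 hI), Complex.log_neg_I]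
    have e3 : Complex.log (Complex.I * (0 - x)) = Real.log x + -(Real.pi / 2) * Complex.I := by
      rw [show Complex.I * (0 - (x : ℂ)) = x * (-Complex.I) by ring,
        Complex.log_ofReal_mul hx0 (neg_ne_zero.2 hI), Complex.log_neg_I]
    have e4 : Complex.log (Complex.I * (b - x)) =
        Real.log (b - x) + Real.pi / 2 * Complex.I := by
      rw [show Complex.I * ((b : ℂ) - (x : ℂ)) = ((b - x : ℝ) : ℂ) * Complex.I by
        push_cast; ring, Complex.log_ofReal_mul hbx hI, Complex.log_I]
    rw [e1, e2, e3, e4]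
    ring
  have hzv : z ∉ polygonalChain v n := fun h => (hdisj z h).1 hz
  have hzv' : z ∉ polygonalChain v' n := fun h => hdisj' z h hz
  have hmain : (2 * Real.pi * Complex.I) • f z =
      polygonalIntegral (fun y => (y - z)⁻¹ • f y) v n -
        polygonalIntegral (fun y => (y - z)⁻¹ • f y) v' n := by
    rw [polygonalIntegral_inv_sub_smul hf hΦ hzv, polygonalIntegral_inv_sub_smul hf hΦ hzv', hv0,
      hvn, hv0', hvn', ← hwind, sub_smul]
    abel
  have hn1 : ‖polygonalIntegral (fun y => (y - z)⁻¹ • f y) v n‖ ≤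
      (∑ i ∈ Finset.range n, ‖v (i + 1) - v i‖) * (d⁻¹ * B) :=
    norm_polygonalIntegral_le fun y hy => by
      rw [norm_smul, norm_inv]
      exact mul_le_mul (inv_anti₀ hd0 (hd y hy).1) (hB y hy).1 (norm_nonneg _)
        (inv_nonneg.2 hd0.le)
  have hn2 : ‖polygonalIntegral (fun y => (y - z)⁻¹ • f y) v' n‖ ≤
      (∑ i ∈ Finset.range n, ‖v' (i + 1) - v' i‖) * (d⁻¹ * B) :=
    norm_polygonalIntegral_le fun y hy => by
      have h1 := (hd _ (hconj y hy)).2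
      have h2 := (hB _ (hconj y hy)).2
      rw [Complex.conj_conj] at h1 h2
      rw [norm_smul, norm_inv]
      exact mul_le_mul (inv_anti₀ hd0 h1) h2 (norm_nonneg _) (inv_nonneg.2 hd0.le)
  have hlen : ∀ i, ‖v' (i + 1) - v' i‖ = ‖v (i + 1) - v i‖ := fun i => by
    rw [hv']
    simp only
    rw [← map_sub, RCLike.norm_conj]
  simp only [hlen] at hn2
  have hnorm : ‖(2 * Real.pi * Complex.I) • f z‖ = 2 * Real.pi * ‖f z‖ := by
    rw [norm_smul]
    simp [abs_of_pos Real.pi_pos]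
  rw [← hnorm, hmain]
  refine (norm_sub_le _ _).trans ?_
  linarith

end PolygonalIntegral

/-! ### Growth of F away from the real axis -/

section EntireFunction

variable {F : ℂ → ℂ} {β B : ℝ}

/-- `re z * cos β - |im z| * sin β`, which is nonnegative exactly on the closed sector with half
angle `π / 2 - β`. -/
noncomputable def dualSectorFun (β : ℝ) (z : ℂ) : ℝ :=
  z.re * Real.cos β - |z.im| * Real.sin β

theorem continuous_dualSectorFun (β : ℝ) : Continuous (dualSectorFun β) := by
  unfold dualSectorFun
  fun_prop

theorem dualSectorFun_conj (β : ℝ) (z : ℂ) :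
    dualSectorFun β ((starRingEnd ℂ) z) = dualSectorFun β z := by
  simp [dualSectorFun]

theorem dualSectorFun_real_mul (β : ℝ) {r : ℝ} (hr : 0 ≤ r) (z : ℂ) :
    dualSectorFun β (r * z) = r * dualSectorFun β z := by
  simp [dualSectorFun, abs_mul, abs_of_nonneg hr]
  ring

theorem norm_mul_sin_le_re_of_dualSectorFun_nonneg (h0 : 0 < β) (h1 : β < Real.pi / 2) {z : ℂ}
    (hz : 0 ≤ dualSectorFun β z) : ‖z‖ * Real.sin β ≤ z.re := by
  have hs : 0 < Real.sin β := Real.sin_pos_of_pos_of_lt_pi h0 (by linarith [Real.pi_pos])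
  have hc : 0 < Real.cos β := Real.cos_pos_of_mem_Ioo ⟨by linarith, h1⟩
  have hz' : |z.im| * Real.sin β ≤ z.re * Real.cos β := sub_nonneg.1 hz
  have hre : 0 ≤ z.re := by
    by_contra hneg
    nlinarith [mul_nonneg (abs_nonneg z.im) hs.le]
  refine abs_le_of_sq_le_sq' ?_ hre |>.2
  have h2 : (|z.im| * Real.sin β) ^ 2 ≤ (z.re * Real.cos β) ^ 2 :=
    pow_le_pow_left₀ (by positivity) hz' 2
  rw [mul_pow, mul_pow, sq_abs] at h2
  rw [mul_pow, Complex.sq_norm, Complex.normSq_apply]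
  nlinarith [Real.sin_sq_add_cos_sq β]

/-- By the identity theorem F is nonzero somewhere on the positive axis; as it vanishes at both
ends, the maximum is attained inside. -/
theorem exists_norm_max_of_tendsto_zero (hd : Differentiable ℂ F) (h0 : F 0 = 0)
    (hlim : Filter.Tendsto (fun t : ℝ => F t) Filter.atTop (nhds 0)) (hne : ∃ z, F z ≠ 0) :
    ∃ b : ℝ, 0 < b ∧ 0 < ‖F b‖ ∧ ∀ t : ℝ, 0 < t → ‖F t‖ ≤ ‖F b‖ := by
  obtain ⟨t₀, ht₀, hFt₀⟩ : ∃ t : ℝ, 0 < t ∧ F t ≠ 0 := by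
    by_contra! hcon
    obtain ⟨z, hz⟩ := hne
    refine hz ?_
    have han : AnalyticOnNhd ℂ F Set.univ := hd.differentiableOn.analyticOnNhd isOpen_univ
    have hfreq : ∃ᶠ w in nhdsWithin (1 : ℂ) {1}ᶜ, F w = 0 := by
      have h1 : Filter.Tendsto (fun t : ℝ => (t : ℂ)) (nhdsWithin 1 (Set.Ioi 1))
          (nhdsWithin (1 : ℂ) {1}ᶜ) := by
        refine tendsto_nhdsWithin_of_tendsto_nhds_of_eventually_within _ ?_ ?_
        · have := Complex.continuous_ofReal.tendsto (1 : ℝ)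
          rw [Complex.ofReal_one] at this
          exact this.mono_left nhdsWithin_le_nhds
        · filter_upwards [self_mem_nhdsWithin] with t ht h
          have : t = 1 := by exact_mod_cast Set.mem_singleton_iff.1 h
          exact absurd this (ne_of_gt ht)
      refine h1.frequently (Filter.Eventually.frequently ?_)
      filter_upwards [self_mem_nhdsWithin] with t ht
      exact hcon t (zero_lt_one.trans ht)
    exact han.eqOn_zero_of_preconnected_of_frequently_eq_zero isPreconnected_univ
      (Set.mem_univ 1) hfreq (Set.mem_univ z)
  have hpos : 0 < ‖F t₀‖ := norm_pos_iff.2 hFt₀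
  obtain ⟨N, hN⟩ := Filter.eventually_atTop.1
    (hlim.norm.eventually (gt_mem_nhds (norm_zero (E := ℂ) ▸ hpos)))
  have hcont : ContinuousOn (fun t : ℝ => ‖F t‖) (Set.Icc 0 (max N t₀)) :=
    (hd.continuous.comp Complex.continuous_ofReal).norm.continuousOn
  have ht₀mem : t₀ ∈ Set.Icc 0 (max N t₀) := ⟨ht₀.le, le_max_right _ _⟩
  obtain ⟨b, hb, hbmax⟩ := isCompact_Icc.exists_isMaxOn ⟨t₀, ht₀mem⟩ hcont
  have hb1 : ‖F t₀‖ ≤ ‖F b‖ := hbmax ht₀mem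
  refine ⟨b, ?_, hpos.trans_le hb1, fun t ht => ?_⟩
  · refine hb.1.lt_of_ne fun h => ?_
    rw [← h, Complex.ofReal_zero, h0, norm_zero] at hb1
    linarith
  · rcases le_or_gt t (max N t₀) with h | h
    · exact hbmax ⟨ht.le, h⟩
    · exact ((hN t ((le_max_left _ _).trans h.le)).le).trans hb1

theorem im_eq_zero_of_conj (hconj : ∀ z, F ((starRingEnd ℂ) z) = (starRingEnd ℂ) (F z)) (t : ℝ) :
    (F t).im = 0 := by
  have := hconj t
  rw [Complex.conj_ofReal] at this
  exact Complex.conj_eq_iff_im.1 this.symm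

/-- Near a maximum of `|F|` on the real axis, `|F|` grows along a direction in the upper half
plane. -/
theorem exists_direction_norm_growth (hd : Differentiable ℂ F) (h0 : F 0 = 0)
    (hconj : ∀ z, F ((starRingEnd ℂ) z) = (starRingEnd ℂ) (F z)) {b : ℝ} (hb : 0 < b)
    (hFb : 0 < ‖F b‖) (hmax : ∀ t : ℝ, 0 < t → ‖F t‖ ≤ ‖F b‖) :
    ∃ (k : ℕ) (c : ℝ) (q : ℂ), 0 < c ∧ 0 < q.im ∧
      ∀ z ∈ segment ℝ (b : ℂ) q, 0 ≤ z.im ∧ ‖F b‖ + c * ‖z - b‖ ^ k ≤ ‖F z‖ := by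
  set m : ℂ := F b with hm
  have hm0 : m ≠ 0 := norm_pos_iff.1 hFb
  set f : ℂ → ℂ := fun z => F z / m - 1 with hf
  have hfd : Differentiable ℂ f := (hd.div_const m).sub_const 1
  have han : AnalyticAt ℂ f b := hfd.analyticAt b
  have hfb : f b = 0 := by simp [hf, ← hm, hm0]
  have hnz : ¬ ∀ᶠ z in nhds (b : ℂ), f z = 0 := by
    intro hev
    have h1 : AnalyticOnNhd ℂ f Set.univ := hfd.differentiableOn.analyticOnNhd isOpen_univ
    have h2 := h1.eqOn_zero_of_preconnected_of_eventuallyEq_zero isPreconnected_univ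
      (Set.mem_univ (b : ℂ)) hev (Set.mem_univ 0)
    simp [hf, h0] at h2
  obtain ⟨k, g, hg, hgb, hev⟩ := han.exists_eventuallyEq_pow_smul_nonzero_iff.2 hnz
  have hfre : ∀ t : ℝ, 0 < t → (f t).re ≤ 0 := fun t ht => by
    have h1 : (F t / m).re ≤ 1 := by
      refine (Complex.re_le_norm _).trans ?_
      rw [norm_div]
      exact (div_le_one hFb).2 (hmax t ht)
    simpa [hf] using h1
  have hfim : ∀ t : ℝ, (f t).im = 0 := fun t => by
    have h1 := im_eq_zero_of_conj hconj t
    have h2 : m.im = 0 := im_eq_zero_of_conj hconj b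
    simp [hf, Complex.div_im, h1, h2]
  have htend : ∀ s : Set ℝ, Filter.Tendsto (fun t : ℝ => (t : ℂ)) (nhdsWithin b s)
      (nhds (b : ℂ)) := fun s =>
    (Complex.continuous_ofReal.tendsto b).mono_left nhdsWithin_le_nhds
  have hgt : ∀ s : Set ℝ, Filter.Tendsto (fun t : ℝ => g t) (nhdsWithin b s) (nhds (g b)) :=
    fun s => hg.continuousAt.tendsto.comp (htend s)
  have hposev : ∀ s : Set ℝ, ∀ᶠ t : ℝ in nhdsWithin b s, 0 < t := fun s =>
    nhdsWithin_le_nhds (lt_mem_nhds hb)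
  have hpow : ∀ t : ℝ, f t = ((t : ℂ) - b) ^ k • g t →
      (f t).re = (t - b) ^ k * (g t).re ∧ (f t).im = (t - b) ^ k * (g t).im := fun t ht => by
    have : ((t : ℂ) - b) ^ k = (((t - b) ^ k : ℝ) : ℂ) := by push_cast; ring
    rw [ht, this, smul_eq_mul, Complex.re_ofReal_mul, Complex.im_ofReal_mul]
    exact ⟨rfl, rfl⟩
  -- On the positive axis f is real and nonpositive, so approaching b from the right shows that the
  -- leading coefficient g(b) is a negative real.
  have hgre : (g b).re ≤ 0 := by
    refine le_of_tendsto ((Complex.continuous_re.tendsto _).comp (hgt (Set.Ioi b))) ?_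
    filter_upwards [(htend (Set.Ioi b)).eventually hev, hposev _, self_mem_nhdsWithin]
      with t ht ht0 htb
    have h1 := hfre t ht0
    rw [(hpow t ht).1] at h1
    exact nonpos_of_mul_nonpos_right h1 (pow_pos (sub_pos.2 htb) k)
  have hgim : (g b).im = 0 := by
    refine tendsto_nhds_unique ((Complex.continuous_im.tendsto _).comp (hgt (Set.Ioi b))) ?_
    refine tendsto_const_nhds.congr' ?_
    filter_upwards [(htend (Set.Ioi b)).eventually hev, self_mem_nhdsWithin] with t ht htb
    have h1 := hfim t
    rw [(hpow t ht).2] at h1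
    exact ((mul_eq_zero.1 h1).resolve_left (pow_pos (sub_pos.2 htb) k).ne').symm
  have hgneg : (g b).re < 0 := hgre.lt_of_ne fun h => hgb (Complex.ext h hgim)
  have hk0 : k ≠ 0 := by
    rintro rfl
    have := hev.self_of_nhds
    rw [hfb] at this
    simp at this
    exact hgb this.symm
  -- A simple zero would make f positive to the left of b.
  have hk1 : k ≠ 1 := by
    rintro rfl
    refine absurd (ge_of_tendsto
      ((Complex.continuous_re.tendsto _).comp (hgt (Set.Iio b))) ?_) (not_le.2 hgneg)
    filter_upwards [(htend (Set.Iio b)).eventually hev, hposev _, self_mem_nhdsWithin]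
      with t ht ht0 htb
    have h1 := hfre t ht0
    rw [(hpow t ht).1, pow_one] at h1
    have htb' : t - b < 0 := sub_neg.2 htb
    exact nonneg_of_mul_nonpos_right h1 htb'
  have hk2 : 2 ≤ k := by omega
  set γ : ℝ := -(g b).re / 2 with hγ
  have hγ0 : 0 < γ := by rw [hγ]; linarith
  have hgev : ∀ᶠ z in nhds (b : ℂ), (g z).re < -γ := by
    have h1 : ContinuousAt (fun z => (g z).re) b :=
      Complex.continuous_re.continuousAt.comp hg.continuousAt
    refine h1.eventually_lt continuousAt_const ?_
    rw [hγ]; linarith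
  obtain ⟨r, hr0, hr⟩ := Metric.eventually_nhds_iff.1 (hev.and hgev)
  -- In this direction (z - b)^k is negative, so f has positive real part; k ≥ 2 makes the direction
  -- point into the upper half plane.
  set θ : ℝ := Real.pi / k with hθ
  have hkpos : (0 : ℝ) < k := by positivity
  have hθ0 : 0 < θ := by positivity
  have hθ1 : θ < Real.pi := by
    rw [hθ, div_lt_iff₀ hkpos]
    have : (2 : ℝ) ≤ k := by exact_mod_cast hk2
    nlinarith [Real.pi_pos]
  set e : ℂ := Complex.exp (θ * Complex.I) with he
  have hene : ‖e‖ = 1 := Complex.norm_exp_ofReal_mul_I θ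
  have heim : 0 < e.im := by
    rw [he, Complex.exp_ofReal_mul_I_im]
    exact Real.sin_pos_of_pos_of_lt_pi hθ0 hθ1
  have hek : e ^ k = -1 := by
    rw [he, ← Complex.exp_nat_mul, hθ]
    have : (k : ℂ) * (((Real.pi / k : ℝ) : ℂ) * Complex.I) = Real.pi * Complex.I := by
      have : (k : ℂ) ≠ 0 := by exact_mod_cast hk0
      push_cast
      field_simp
    rw [this, Complex.exp_pi_mul_I]
  refine ⟨k, ‖m‖ * γ, b + ((r / 2 : ℝ) : ℂ) * e, by positivity, ?_, ?_⟩
  · rw [Complex.add_im, Complex.ofReal_im, Complex.im_ofReal_mul, zero_add]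
    positivity
  · intro z hz
    rw [segment_eq_image'] at hz
    obtain ⟨t, ht, rfl⟩ := hz
    set ρ : ℝ := t * (r / 2) with hρ
    have hρ0 : 0 ≤ ρ := mul_nonneg ht.1 (by positivity)
    have hz : (b : ℂ) + t • (b + ((r / 2 : ℝ) : ℂ) * e - b) = b + (ρ : ℂ) * e := by
      rw [Complex.real_smul, hρ]
      push_cast
      ring
    simp only
    rw [hz]
    refine ⟨?_, ?_⟩
    · rw [Complex.add_im, Complex.ofReal_im, Complex.im_ofReal_mul, zero_add]
      positivity
    have hnorm : ‖(b : ℂ) + (ρ : ℂ) * e - b‖ = ρ := by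
      rw [add_sub_cancel_left, norm_mul, hene, mul_one, Complex.norm_real,
        Real.norm_of_nonneg hρ0]
    have hdist : dist ((b : ℂ) + (ρ : ℂ) * e) b < r := by
      rw [dist_eq_norm, hnorm, hρ]
      nlinarith [ht.2]
    obtain ⟨h1, h2⟩ := hr hdist
    rw [hnorm]
    set z : ℂ := (b : ℂ) + (ρ : ℂ) * e with hzdef
    have hpowz : (z - b) ^ k = ((-ρ ^ k : ℝ) : ℂ) := by
      rw [hzdef, add_sub_cancel_left, mul_pow, hek]
      push_cast
      ring
    have hre : ρ ^ k * γ ≤ (f z).re := by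
      rw [h1, hpowz, smul_eq_mul, Complex.re_ofReal_mul]
      nlinarith [pow_nonneg hρ0 k]
    have hFz : F z = m * (1 + f z) := by
      simp only [hf]
      field_simp
      ring
    rw [hFz, norm_mul]
    have : 1 + ρ ^ k * γ ≤ ‖1 + f z‖ := by
      refine le_trans ?_ (Complex.re_le_norm _)
      rw [Complex.add_re, Complex.one_re]
      linarith
    calc ‖m‖ + ‖m‖ * γ * ρ ^ k = ‖m‖ * (1 + ρ ^ k * γ) := by ring
      _ ≤ _ := by gcongr

/-- The polygonal component of `q` in `{im z > 0, |F z| > |F b|}` leaves the sector on which `F` is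
bounded. -/
theorem exists_reachable_dualSectorFun_neg (hβ0 : 0 < β) (hβ1 : β < Real.pi / 2)
    (hd : Differentiable ℂ F) (h0 : F 0 = 0)
    (hB : ∀ z, 0 ≤ dualSectorFun β z → ‖F z‖ ≤ B) {b : ℝ}
    (hFb : 0 < ‖F b‖) (hmax : ∀ t : ℝ, 0 < t → ‖F t‖ ≤ ‖F b‖) {q : ℂ} (hq : 0 < q.im)
    (hFq : ‖F b‖ < ‖F q‖) :
    ∃ p : ℂ, dualSectorFun β p < 0 ∧ 0 < p.im ∧
      Relation.ReflTransGen
        (fun x y => segment ℝ x y ⊆ {z : ℂ | 0 < z.im ∧ ‖F b‖ < ‖F z‖}) q p := by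
  set V : Set ℂ := {z : ℂ | 0 < z.im ∧ ‖F b‖ < ‖F z‖} with hV
  set E : Set ℂ := {z | Relation.ReflTransGen (fun x y => segment ℝ x y ⊆ V) q z} with hE
  have hVopen : IsOpen V :=
    (isOpen_lt continuous_const Complex.continuous_im).inter
      (isOpen_lt continuous_const hd.continuous.norm)
  have hEV : E ⊆ V := by
    intro z hz
    rcases Relation.ReflTransGen.cases_tail hz with h | ⟨y, _, hy⟩
    · rw [h]; exact ⟨hq, hFq⟩
    · exact hy (right_mem_segment ℝ y z)
  have hball : ∀ z ∈ V, ∃ δ > 0, Metric.ball z δ ⊆ V := fun z hz =>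
    Metric.isOpen_iff.1 hVopen z hz
  have hEopen : IsOpen E := by
    rw [Metric.isOpen_iff]
    intro z hz
    obtain ⟨δ, hδ, hsub⟩ := hball z (hEV hz)
    refine ⟨δ, hδ, fun w hw => Relation.ReflTransGen.tail hz ?_⟩
    exact ((convex_ball z δ).segment_subset (Metric.mem_ball_self hδ) hw).trans hsub
  have hclos : ∀ w ∈ closure E, w ∈ V → w ∈ E := by
    intro w hw hwV
    obtain ⟨δ, hδ, hsub⟩ := hball w hwV
    obtain ⟨y, hy, hyw⟩ := Metric.mem_closure_iff.1 hw δ hδ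
    refine Relation.ReflTransGen.tail hy ?_
    refine ((convex_ball w δ).segment_subset ?_ (Metric.mem_ball_self hδ)).trans hsub
    rwa [Metric.mem_ball, dist_comm]
  -- Phragmén–Lindelöf: if E stayed in the sector, F e^{-εz} would be small far out in E and at most
  -- |F b| on the remaining boundary; ε → 0 then contradicts |F q| > |F b|.
  by_contra! hcon
  have hEl : E ⊆ {z | 0 ≤ dualSectorFun β z} := fun z hz => by
    by_contra hneg
    exact hcon z (not_le.1 hneg) (hEV hz).1 hz
  have hclosl : closure E ⊆ {z | 0 ≤ dualSectorFun β z} :=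
    closure_minimal hEl (isClosed_le continuous_const (continuous_dualSectorFun β))
  have hclosim : closure E ⊆ {z | 0 ≤ z.im} :=
    closure_minimal (fun z hz => (hEV hz).1.le)
      (isClosed_le continuous_const Complex.continuous_im)
  have hs : 0 < Real.sin β := Real.sin_pos_of_pos_of_lt_pi hβ0 (by linarith [Real.pi_pos])
  have hre : ∀ z ∈ closure E, ‖z‖ * Real.sin β ≤ z.re := fun z hz =>
    norm_mul_sin_le_re_of_dualSectorFun_nonneg hβ0 hβ1 (hclosl hz)
  have hbound : ∀ ε : ℝ, 0 < ε → ‖F q‖ * Real.exp (-ε * q.re) ≤ ‖F b‖ := by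
    intro ε hε
    have hB0 : 0 ≤ B := (norm_nonneg _).trans (hB 0 (by simp [dualSectorFun]))
    obtain ⟨R, hRq, hR⟩ : ∃ R : ℝ, ‖q‖ < R ∧ B * Real.exp (-(ε * Real.sin β) * R) ≤ ‖F b‖ := by
      have hlim : Filter.Tendsto (fun R : ℝ => B * Real.exp (-(ε * Real.sin β) * R))
          Filter.atTop (nhds (B * 0)) := by
        refine Filter.Tendsto.const_mul B (Real.tendsto_exp_atBot.comp ?_)
        exact Filter.tendsto_id.const_mul_atTop_of_neg (neg_neg_of_pos (mul_pos hε hs))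
      rw [mul_zero] at hlim
      obtain ⟨R, h1, h2⟩ := ((Filter.eventually_gt_atTop ‖q‖).and
        (hlim.eventually (gt_mem_nhds hFb))).exists
      exact ⟨R, h1, h2.le⟩
    have hnorm : ∀ z : ℂ, ‖F z * Complex.exp (-(ε : ℂ) * z)‖ =
        ‖F z‖ * Real.exp (-ε * z.re) := fun z => by
      rw [norm_mul, Complex.norm_exp, ← Complex.ofReal_neg, Complex.re_ofReal_mul]
    have hdiff : Differentiable ℂ fun z => F z * Complex.exp (-(ε : ℂ) * z) := by fun_prop
    have hUb : Bornology.IsBounded (E ∩ Metric.ball 0 R) :=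
      Metric.isBounded_ball.subset Set.inter_subset_right
    have := Complex.norm_le_of_forall_mem_frontier_norm_le hUb hdiff.diffContOnCl (C := ‖F b‖)
      (z := q) ?_ (subset_closure ⟨Relation.ReflTransGen.refl, by simpa using hRq⟩)
    · rwa [hnorm] at this
    intro w hw
    have hwE : w ∈ closure E := closure_mono Set.inter_subset_left hw.1
    have hwre := hre w hwE
    have hwre0 : 0 ≤ w.re := (by positivity : (0 : ℝ) ≤ ‖w‖ * Real.sin β).trans hwre
    rw [hnorm]
    rcases lt_or_ge ‖w‖ R with hlt | hge
    -- E is open and relatively closed in V, so such a frontier point lies outside V: it is real, or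
    -- |F| ≤ |F b| there.
    · have hwnE : w ∉ E := fun h => by
        refine (hEopen.inter Metric.isOpen_ball).inter_frontier_eq.le
          ⟨⟨h, ?_⟩, hw⟩
        simpa using hlt
      have hwnV : w ∉ V := fun h => hwnE (hclos w hwE h)
      have hFw : ‖F w‖ ≤ ‖F b‖ := by
        rcases (show 0 ≤ w.im from hclosim hwE).eq_or_lt with him | him
        · have hwr : w = (w.re : ℂ) := Complex.ext rfl (by simp [← him])
          rcases hwre0.eq_or_lt with h | h
          · rw [hwr, ← h, Complex.ofReal_zero, h0, norm_zero]
            exact hFb.le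
          · rw [hwr]; exact hmax _ h
        · by_contra hgt
          exact hwnV ⟨him, not_le.1 hgt⟩
      calc _ ≤ ‖F b‖ * 1 := by
            gcongr
            exact Real.exp_le_one_iff.2 (by nlinarith)
        _ = _ := mul_one _
    · have hRw : R * Real.sin β ≤ w.re := le_trans (by gcongr) hwre
      calc _ ≤ B * Real.exp (-(ε * Real.sin β) * R) := by
            refine mul_le_mul (hB w (hclosl hwE)) (Real.exp_le_exp.2 ?_) (Real.exp_pos _).le hB0
            nlinarith
        _ ≤ _ := hR
  have hlim : Filter.Tendsto (fun ε : ℝ => ‖F q‖ * Real.exp (-ε * q.re))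
      (nhdsWithin 0 (Set.Ioi 0)) (nhds (‖F q‖ * Real.exp (-0 * q.re))) :=
    (Continuous.tendsto (by fun_prop) 0).mono_left nhdsWithin_le_nhds
  rw [neg_zero, zero_mul, Real.exp_zero, mul_one] at hlim
  refine absurd (le_of_tendsto hlim ?_) (not_le.2 hFq)
  filter_upwards [self_mem_nhdsWithin] with ε hε using hbound ε hε

theorem exists_chain_of_reflTransGen {r : ℂ → ℂ → Prop} {x y : ℂ}
    (h : Relation.ReflTransGen r x y) :
    ∃ (n : ℕ) (v : ℕ → ℂ), v 0 = x ∧ v n = y ∧ ∀ i < n, r (v i) (v (i + 1)) := by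
  induction h with
  | refl => exact ⟨0, fun _ => x, rfl, rfl, fun i hi => absurd hi (Nat.not_lt_zero i)⟩
  | @tail y z _ hyz ih =>
    obtain ⟨n, v, h0, hn, hr⟩ := ih
    refine ⟨n + 1, fun i => if i ≤ n then v i else z, by simp [h0], by simp, fun i hi => ?_⟩
    rcases (Nat.lt_succ_iff.1 hi).lt_or_eq with h | h
    · simpa [h.le, Nat.succ_le_of_lt h] using hr i h
    · subst h
      simpa [hn] using hyz

end EntireFunction

/-! ### A bound on a small circle that is uniform in f -/

section UniformBound

variable {E : Type*} [NormedAddCommGroup E] {F : ℂ → ℂ} {β B m C₁ D κ : ℝ}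

theorem isCompact_segment (x y : ℂ) : IsCompact (segment ℝ x y) := by
  rw [segment_eq_image_lineMap]
  exact isCompact_Icc.image (AffineMap.lineMap_continuous (R := ℝ))

/-- A uniform bound on compact sets where `m + c * |z - b| ^ k ≤ |F z|`. -/
theorem exists_bound_of_growth {S : Set ℂ} (hS : IsCompact S) (b : ℂ) (k : ℕ) {c : ℝ}
    (hc : 0 < c) (hF : ∀ z ∈ S, m + c * ‖z - b‖ ^ k ≤ ‖F z‖) :
    ∃ C : ℝ, ∀ f : ℂ → E, (∀ z, (‖F z‖ - m) * ‖f z‖ ≤ D * Real.exp (κ * ‖z‖)) →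
      ∀ z ∈ S, ‖z‖ * ‖z - b‖ ^ k * ‖f z‖ ≤ C := by
  obtain ⟨C, hC⟩ := hS.exists_bound_of_continuousOn
    (f := fun z : ℂ => ‖z‖ * (c⁻¹ * (D * Real.exp (κ * ‖z‖)))) (by fun_prop)
  refine ⟨C, fun f hf z hz => le_trans ?_ ((le_abs_self _).trans (hC z hz))⟩
  rw [mul_assoc]
  refine mul_le_mul_of_nonneg_left ?_ (norm_nonneg z)
  rw [le_inv_mul_iff₀ hc, ← mul_assoc]
  refine le_trans ?_ (hf z)
  gcongr
  linarith [hF z hz]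

/-- A uniform bound on compact sets where `m < |F z|`. -/
theorem exists_bound_of_lt (hd : Continuous F) {S : Set ℂ} (hS : IsCompact S) (b : ℂ) (k : ℕ)
    (hF : ∀ z ∈ S, m < ‖F z‖) :
    ∃ C : ℝ, ∀ f : ℂ → E, (∀ z, (‖F z‖ - m) * ‖f z‖ ≤ D * Real.exp (κ * ‖z‖)) →
      ∀ z ∈ S, ‖z‖ * ‖z - b‖ ^ k * ‖f z‖ ≤ C := by
  obtain ⟨C, hC⟩ := hS.exists_bound_of_continuousOn
    (f := fun z : ℂ => ‖z‖ * ‖z - b‖ ^ k * ((‖F z‖ - m)⁻¹ * (D * Real.exp (κ * ‖z‖))))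
    (by
      refine ContinuousOn.mul (by fun_prop) (ContinuousOn.mul ?_ (by fun_prop))
      exact ContinuousOn.inv₀ (by fun_prop) fun z hz => (sub_pos.2 (hF z hz)).ne')
  refine ⟨C, fun f hf z hz => le_trans ?_ ((le_abs_self _).trans (hC z hz))⟩
  gcongr
  rw [le_inv_mul_iff₀ (sub_pos.2 (hF z hz))]
  exact hf z

/-- A uniform bound on a segment from `0` outside of the dual sector. -/
theorem exists_bound_of_dualSectorFun_neg {p : ℂ} (hp : dualSectorFun β p < 0) (b : ℂ) (k : ℕ)
    (hC₁ : 0 ≤ C₁) :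
    ∃ C : ℝ, ∀ f : ℂ → E, (∀ z, dualSectorFun β z < 0 → ‖f z‖ ≤ C₁ / (-dualSectorFun β z)) →
      ∀ z ∈ segment ℝ p 0, ‖z‖ * ‖z - b‖ ^ k * ‖f z‖ ≤ C := by
  obtain ⟨C, hC⟩ := (isCompact_segment p 0).exists_bound_of_continuousOn
    (f := fun z : ℂ => ‖z - b‖ ^ k * (‖p‖ * (C₁ / (-dualSectorFun β p)))) (by fun_prop)
  refine ⟨C, fun f hf z hz => le_trans ?_ ((le_abs_self _).trans (hC z hz))⟩
  rw [mul_comm ‖z‖, mul_assoc]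
  refine mul_le_mul_of_nonneg_left ?_ (pow_nonneg (norm_nonneg _) k)
  rw [segment_symm, segment_eq_image'] at hz
  obtain ⟨t, ht, rfl⟩ := hz
  simp only [sub_zero, zero_add, Complex.real_smul]
  rcases ht.1.eq_or_lt with rfl | ht0
  · simp only [Complex.ofReal_zero, zero_mul, norm_zero]
    exact mul_nonneg (norm_nonneg _) (div_nonneg hC₁ (neg_nonneg.2 hp.le))
  · have hl := dualSectorFun_real_mul β ht0.le p
    -- Along the ray through p the bound has a simple pole at 0, by homogeneity of `dualSectorFun`;
    -- the factor ‖z‖ cancels it.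
    have h1 := hf (t * p) (by rw [hl]; exact mul_neg_of_pos_of_neg ht0 hp)
    rw [hl] at h1
    rw [norm_mul, Complex.norm_real, Real.norm_of_nonneg ht0.le]
    calc t * ‖p‖ * ‖f (t * p)‖ ≤ t * ‖p‖ * (C₁ / (-(t * dualSectorFun β p))) := by gcongr
      _ = ‖p‖ * (C₁ / (-dualSectorFun β p)) := by
        have := hp.ne
        field_simp

theorem convex_sector (a d : ℝ) (ha : 0 ≤ a) : Convex ℝ {z : ℂ | a * |z.im| < z.re * d} := by
  intro x hx y hy s t hs ht hst
  change a * |x.im| < x.re * d at hx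
  change a * |y.im| < y.re * d at hy
  change a * |(s • x + t • y).im| < (s • x + t • y).re * d
  have h1 : |(s • x + t • y).im| ≤ s * |x.im| + t * |y.im| := by
    have : (s • x + t • y).im = s * x.im + t * y.im := by simp
    rw [this]
    refine (abs_add_le _ _).trans ?_
    rw [abs_mul, abs_mul, abs_of_nonneg hs, abs_of_nonneg ht]
  have h2 : (s • x + t • y).re = s * x.re + t * y.re := by simp
  rw [h2]
  refine lt_of_le_of_lt (mul_le_mul_of_nonneg_left h1 ha) ?_
  rcases hs.eq_or_lt with rfl | hs0
  · have : t = 1 := by linarith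
    subst this
    simpa using hy
  · have h3 : s * (a * |x.im|) < s * (x.re * d) := by gcongr
    have h4 : t * (a * |y.im|) ≤ t * (y.re * d) := by gcongr
    nlinarith

variable [NormedSpace ℂ E] [CompleteSpace E]

/-- The polygon and all constants depend only on F, b and the constants in the hypotheses. Hence C
is chosen before f, as is needed when f varies with u. -/
theorem exists_uniform_bound_on_sphere (hβ0 : 0 < β) (hβ1 : β < Real.pi / 2)
    (hd : Differentiable ℂ F) (h0 : F 0 = 0)
    (hconj : ∀ z, F ((starRingEnd ℂ) z) = (starRingEnd ℂ) (F z))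
    (hB : ∀ z, 0 ≤ dualSectorFun β z → ‖F z‖ ≤ B) {b : ℝ} (hb : 0 < b)
    (hFb : 0 < ‖F b‖) (hmax : ∀ t : ℝ, 0 < t → ‖F t‖ ≤ ‖F b‖) (hC₁ : 0 ≤ C₁) :
    ∃ r : ℝ, 0 < r ∧ ∃ C : ℝ, ∀ f : ℂ → E, Differentiable ℂ f →
      (∀ z, dualSectorFun β z < 0 → ‖f z‖ ≤ C₁ / (-dualSectorFun β z)) →
      (∀ z, (‖F z‖ - ‖F b‖) * ‖f z‖ ≤ D * Real.exp (κ * ‖z‖)) →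
      ∀ z, ‖z‖ = r → ‖f z‖ ≤ C := by
  obtain ⟨k, c, q, hc, hq, hseg⟩ := exists_direction_norm_growth hd h0 hconj hb hFb hmax
  have hqb : 0 < ‖q - b‖ := norm_pos_iff.2 fun h => by
    have := sub_eq_zero.1 h
    rw [this, Complex.ofReal_im] at hq
    exact lt_irrefl _ hq
  have hFq : ‖F b‖ < ‖F q‖ := lt_of_lt_of_le
    (lt_add_of_pos_right _ (by positivity)) (hseg q (right_mem_segment ℝ _ q)).2
  obtain ⟨p, hpl, hpim, hqp⟩ :=
    exists_reachable_dualSectorFun_neg hβ0 hβ1 hd h0 hB hFb hmax hq hFq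
  set V : Set ℂ := {z : ℂ | 0 < z.im ∧ ‖F b‖ < ‖F z‖} with hV
  set rel : ℂ → ℂ → Prop :=
    fun x y => segment ℝ x y ⊆ V ∨ (x = b ∧ y = q) ∨ (x = p ∧ y = 0) with hrel
  have hqp' : Relation.ReflTransGen rel q p :=
    Relation.ReflTransGen.mono (fun x y h => Or.inl h) _ _ hqp
  have hbq : rel b q := Or.inr (Or.inl ⟨rfl, rfl⟩)
  have hp0 : rel p 0 := Or.inr (Or.inr ⟨rfl, rfl⟩)
  obtain ⟨n, v, hv0, hvn, hv⟩ := exists_chain_of_reflTransGen ((hqp'.head hbq).tail hp0)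
  -- a uniform bound on the chain
  obtain ⟨CΓ, hCΓ⟩ : ∃ CΓ : ℝ, ∀ f : ℂ → E,
      (∀ z, dualSectorFun β z < 0 → ‖f z‖ ≤ C₁ / (-dualSectorFun β z)) →
      (∀ z, (‖F z‖ - ‖F b‖) * ‖f z‖ ≤ D * Real.exp (κ * ‖z‖)) →
      ∀ z ∈ polygonalChain v n, ‖z‖ * ‖z - b‖ ^ k * ‖f z‖ ≤ CΓ := by
    have hi : ∀ i : ℕ, ∃ C : ℝ, i < n → ∀ f : ℂ → E,
        (∀ z, dualSectorFun β z < 0 → ‖f z‖ ≤ C₁ / (-dualSectorFun β z)) →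
        (∀ z, (‖F z‖ - ‖F b‖) * ‖f z‖ ≤ D * Real.exp (κ * ‖z‖)) →
        ∀ z ∈ segment ℝ (v i) (v (i + 1)), ‖z‖ * ‖z - b‖ ^ k * ‖f z‖ ≤ C := by
      intro i
      by_cases hin : i < n
      · rcases hv i hin with h | ⟨h1, h2⟩ | ⟨h1, h2⟩
        · obtain ⟨C, hC⟩ := exists_bound_of_lt (E := E) (m := ‖F b‖) (D := D) (κ := κ)
            hd.continuous (isCompact_segment (v i) (v (i + 1))) b k fun z hz => (h hz).2
          exact ⟨C, fun _ f _ hf => hC f hf⟩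
        · obtain ⟨C, hC⟩ := exists_bound_of_growth (E := E) (m := ‖F b‖) (D := D) (κ := κ)
            (isCompact_segment (b : ℂ) q) b k hc fun z hz => (hseg z hz).2
          rw [h1, h2]
          exact ⟨C, fun _ f _ hf => hC f hf⟩
        · obtain ⟨C, hC⟩ := exists_bound_of_dualSectorFun_neg (E := E) hpl (b : ℂ) k hC₁
          rw [h1, h2]
          exact ⟨C, fun _ f hf _ => hC f hf⟩
      · exact ⟨0, fun h => absurd h hin⟩
    choose C hC using hi
    obtain ⟨CΓ, hCΓ⟩ := ((Finset.range n).image C).exists_le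
    refine ⟨CΓ, fun f hf1 hf2 z hz => ?_⟩
    obtain ⟨i, hin, hz⟩ := mem_polygonalChain.1 hz
    exact (hC i hin f hf1 hf2 z hz).trans
      (hCΓ _ (Finset.mem_image_of_mem C (Finset.mem_range.2 hin)))
  -- the convex region
  obtain ⟨ρ, hρ0, hρ⟩ : ∃ ρ > 0, ∀ z : ℂ, ‖z‖ < ρ → ‖F z‖ < ‖F b‖ := by
    have h1 : ∀ᶠ z in nhds (0 : ℂ), ‖F z‖ < ‖F b‖ := by
      have : ContinuousAt (fun z => ‖F z‖) 0 := hd.continuous.norm.continuousAt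
      refine this.eventually_lt continuousAt_const ?_
      rwa [h0, norm_zero]
    obtain ⟨ρ, hρ0, hρ⟩ := Metric.eventually_nhds_iff.1 h1
    exact ⟨ρ, hρ0, fun z hz => hρ (by rwa [dist_zero_right])⟩
  -- The sector in S is bounded by the rays through p and its conjugate; if re p < 0 it is cut down
  -- to the right half plane to keep it convex.
  set a : ℝ := max p.re 0 with ha
  have ha0 : 0 ≤ a := le_max_right _ _
  set S : Set ℂ := {z : ℂ | a * |z.im| < z.re * p.im} ∩ Metric.ball 0 ρ with hS
  have hSconv : Convex ℝ S := (convex_sector a p.im ha0).inter (convex_ball 0 ρ)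
  have hSconj : ∀ z, (starRingEnd ℂ) z ∈ S → z ∈ S := fun z hz => by simpa [hS] using hz
  have hchain : ∀ y ∈ polygonalChain v n, 0 ≤ y.im ∧ y ∉ S := by
    intro y hy
    obtain ⟨i, hin, hy⟩ := mem_polygonalChain.1 hy
    have hnot : ‖F b‖ ≤ ‖F y‖ → y ∉ S := fun h hyS =>
      absurd (hρ y (by simpa using hyS.2)) (not_lt.2 h)
    rcases hv i hin with h | ⟨h1, h2⟩ | ⟨h1, h2⟩
    · exact ⟨(h hy).1.le, hnot (h hy).2.le⟩
    · rw [h1, h2] at hy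
      refine ⟨(hseg y hy).1, hnot (le_trans ?_ (hseg y hy).2)⟩
      exact le_add_of_nonneg_right (by positivity)
    · rw [h1, h2, segment_symm, segment_eq_image'] at hy
      obtain ⟨t, ht, rfl⟩ := hy
      simp only [sub_zero, zero_add, Complex.real_smul]
      refine ⟨by rw [Complex.im_ofReal_mul]; exact mul_nonneg ht.1 hpim.le, fun hyS => ?_⟩
      have h3 : a * |((t : ℂ) * p).im| < ((t : ℂ) * p).re * p.im := hyS.1
      rw [Complex.im_ofReal_mul, Complex.re_ofReal_mul, abs_mul, abs_of_pos hpim,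
        abs_of_nonneg ht.1] at h3
      nlinarith [mul_nonneg (mul_nonneg ht.1 hpim.le) (sub_nonneg.2 (le_max_left p.re 0))]
  have hdisj : ∀ y ∈ polygonalChain v n, y ∉ S ∧ (starRingEnd ℂ) y ∉ S := fun y hy =>
    ⟨(hchain y hy).2, fun h => (hchain y hy).2 (hSconj y h)⟩
  set r : ℝ := ρ / 2 with hr
  have hr0 : 0 < r := by positivity
  have hrb : r < b := by
    by_contra! h
    refine lt_irrefl _ (hρ b ?_)
    rw [Complex.norm_real, Real.norm_of_nonneg hb.le]
    linarith
  have hrS : (r : ℂ) ∈ S := by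
    refine ⟨?_, ?_⟩
    · simpa using mul_pos hr0 hpim
    · rw [mem_ball_zero_iff, Complex.norm_real, Real.norm_of_nonneg hr0.le]
      linarith
  -- splitting the sphere
  have hs : 0 < Real.sin β := Real.sin_pos_of_pos_of_lt_pi hβ0 (by linarith [Real.pi_pos])
  have hcos : 0 < Real.cos β := Real.cos_pos_of_mem_Ioo ⟨by linarith, hβ1⟩
  -- As p lies outside the dual sector, the sector in S is wider than the dual sector, so at each
  -- point of the circle one of the two quantities is positive.
  obtain ⟨ε, hε0, hε⟩ : ∃ ε : ℝ, 0 < ε ∧ ∀ z ∈ Metric.sphere (0 : ℂ) r,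
      ε ≤ max (z.re * p.im - a * |z.im|) (-dualSectorFun β z) := by
    refine (isCompact_sphere (0 : ℂ) r).exists_forall_le' ?_ fun z hz => ?_
    · have := continuous_dualSectorFun β
      fun_prop
    · rcases lt_or_ge (dualSectorFun β z) 0 with h | h
      · exact lt_max_of_lt_right (neg_pos.2 h)
      · refine lt_max_of_lt_left (sub_pos.2 ?_)
        have hzn : ‖z‖ = r := by simpa using hz
        have hzre : 0 < z.re := lt_of_lt_of_le (by rw [hzn]; positivity)
          (norm_mul_sin_le_re_of_dualSectorFun_nonneg hβ0 hβ1 h)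
        rcases le_or_gt p.re 0 with hp | hp
        · rw [ha, max_eq_right hp, zero_mul]
          positivity
        · rw [ha, max_eq_left hp.le]
          have h1 : |z.im| * Real.sin β ≤ z.re * Real.cos β := sub_nonneg.1 h
          have h2 : p.re * Real.cos β < p.im * Real.sin β := by
            have := sub_neg.1 hpl
            rwa [abs_of_pos hpim] at this
          have h3 : p.re * (|z.im| * Real.sin β) ≤ p.re * (z.re * Real.cos β) := by gcongr
          have h4 : z.re * (p.re * Real.cos β) < z.re * (p.im * Real.sin β) := by gcongr
          by_contra! h5
          nlinarith
  set Z : Set ℂ := {z ∈ Metric.sphere (0 : ℂ) r | ε ≤ z.re * p.im - a * |z.im|} with hZ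
  have hcZ : Continuous fun z : ℂ => z.re * p.im - a * |z.im| := by fun_prop
  have hZcomp : IsCompact Z :=
    (isCompact_sphere (0 : ℂ) r).inter_right (isClosed_le continuous_const hcZ)
  have hZS : Z ⊆ S := fun z hz => by
    refine ⟨sub_pos.1 (hε0.trans_le hz.2), ?_⟩
    have : ‖z‖ = r := by simpa using hz.1
    rw [mem_ball_zero_iff, this]
    linarith
  obtain ⟨δ, hδ0, hδ⟩ : ∃ δ : ℝ, 0 < δ ∧ ∀ w ∈ polygonalChain v n ×ˢ Z,
      δ ≤ min ‖w.1 - w.2‖ ‖(starRingEnd ℂ) w.1 - w.2‖ := by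
    refine ((isCompact_polygonalChain v n).prod hZcomp).exists_forall_le' ?_ fun w hw => ?_
    · have h1 : Continuous fun w : ℂ × ℂ => (starRingEnd ℂ) w.1 :=
        Complex.continuous_conj.comp continuous_fst
      exact ((continuous_fst.sub continuous_snd).norm.min
        (h1.sub continuous_snd).norm).continuousOn
    · have hwS := hZS hw.2
      refine lt_min (norm_pos_iff.2 fun h => ?_) (norm_pos_iff.2 fun h => ?_)
      · exact (hdisj _ hw.1).1 (by rwa [sub_eq_zero.1 h])
      · exact (hdisj _ hw.1).2 (by rwa [sub_eq_zero.1 h])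
  set ℓ : ℝ := ∑ i ∈ Finset.range n, ‖v (i + 1) - v i‖ with hℓ
  have hw0 : 0 < r * (b - r) ^ k := mul_pos hr0 (pow_pos (sub_pos.2 hrb) k)
  refine ⟨r, hr0, max (2 * ℓ * (δ⁻¹ * CΓ) / (2 * Real.pi) / (r * (b - r) ^ k)) (C₁ / ε),
    fun f hf hf1 hf2 z hz => ?_⟩
  rcases le_max_iff.1 (hε z (by simpa using hz)) with h | h
  · refine le_max_of_le_left ?_
    have hzZ : z ∈ Z := ⟨by simpa using hz, h⟩
    set g : ℂ → E := fun y => (y * (y - b) ^ k) • f y with hg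
    have hgd : Differentiable ℂ g := by
      have : Differentiable ℂ fun y : ℂ => y * (y - b) ^ k := by fun_prop
      exact this.smul hf
    have hgn : ∀ y, ‖g y‖ = ‖y‖ * ‖y - b‖ ^ k * ‖f y‖ := fun y => by
      rw [hg]
      simp only
      rw [norm_smul, norm_mul, norm_pow]
    have hgB : ∀ y ∈ polygonalChain v n, ‖g y‖ ≤ CΓ ∧ ‖g ((starRingEnd ℂ) y)‖ ≤ CΓ := by
      intro y hy
      refine ⟨by rw [hgn]; exact hCΓ f hf1 hf2 y hy, ?_⟩
      -- The conjugated argument destroys holomorphy, but the bound on the chain uses only the two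
      -- size conditions, and both are invariant under conjugation.
      have h1 := hCΓ (fun y => f ((starRingEnd ℂ) y))
        (fun w hw => by
          have := hf1 ((starRingEnd ℂ) w)
          rw [dualSectorFun_conj] at this
          exact this hw)
        (fun w => by
          have := hf2 ((starRingEnd ℂ) w)
          rwa [hconj, RCLike.norm_conj, RCLike.norm_conj] at this) y hy
      rw [hgn]
      have h2 : ‖(starRingEnd ℂ) y - b‖ = ‖y - b‖ := by
        rw [← RCLike.norm_conj (y - b), map_sub, Complex.conj_ofReal]
      rwa [h2, RCLike.norm_conj]
    have hmain := norm_le_of_polygonalChain hv0 hvn (fun y hy => (hchain y hy).1) hSconv hdisj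
      hr0 hrb hrS (hZS hzZ) hgd hδ0
      (fun y hy => le_min_iff.1 (hδ (y, z) ⟨hy, hzZ⟩)) hgB
    have hlow : r * (b - r) ^ k * ‖f z‖ ≤ ‖g z‖ := by
      rw [hgn, hz]
      have h3 : b - r ≤ ‖z - b‖ := by
        have := norm_sub_norm_le (b : ℂ) z
        rw [Complex.norm_real, Real.norm_of_nonneg hb.le, hz] at this
        rwa [norm_sub_rev] at this
      have h4 : 0 ≤ b - r := (sub_pos.2 hrb).le
      gcongr
    rw [le_div_iff₀ hw0, le_div_iff₀ (by positivity)]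
    calc _ = 2 * Real.pi * (r * (b - r) ^ k * ‖f z‖) := by ring
      _ ≤ 2 * Real.pi * ‖g z‖ := by gcongr
      _ ≤ _ := hmain
  · refine le_max_of_le_right ?_
    refine (hf1 z (by linarith)).trans ?_
    gcongr

end UniformBound

/-! ### Properties of F on the dual sector, and the contradiction -/

section MainTheorem

variable {β : ℝ} {μ : ComplexMeasure ℂ} {K : Set ℂ}

/-- The arguments are at most π/2 - β and β in modulus, so the product stays in the closed right
half plane. -/
theorem re_mul_nonneg_of_dualSectorFun_nonneg (h0 : 0 < β) (h1 : β < Real.pi / 2) {z ξ : ℂ}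
    (hz : 0 ≤ dualSectorFun β z) (hξ : ξ ∈ closedSector β) : 0 ≤ (z * ξ).re := by
  have hs : 0 < Real.sin β := Real.sin_pos_of_pos_of_lt_pi h0 (by linarith [Real.pi_pos])
  have hc : 0 < Real.cos β := Real.cos_pos_of_mem_Ioo ⟨by linarith, h1⟩
  obtain ⟨hξre, hξim⟩ := (mem_closedSector_iff h0 h1).1 hξ
  have hz' : |z.im| * Real.sin β ≤ z.re * Real.cos β := sub_nonneg.1 hz
  have h2 : (|z.im| * Real.sin β) * (|ξ.im| * Real.cos β) ≤
      (z.re * Real.cos β) * (ξ.re * Real.sin β) :=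
    mul_le_mul hz' hξim (by positivity) ((by positivity : 0 ≤ |z.im| * Real.sin β).trans hz')
  have h3 : |z.im| * |ξ.im| ≤ z.re * ξ.re := by
    by_contra! h
    nlinarith [mul_pos hs hc]
  rw [Complex.mul_re]
  have := le_abs_self (z.im * ξ.im)
  rw [abs_mul] at this
  linarith

theorem IsSupportedOn.norm_fourierBorel_le_of_dualSectorFun_nonneg (h : IsSupportedOn μ K)
    (hK : IsCompact K) (hKβ : K ⊆ closedSector β) (h0 : 0 < β) (h1 : β < Real.pi / 2) {z : ℂ}
    (hz : 0 ≤ dualSectorFun β z) : ‖fourierBorel μ z‖ ≤ μ.variation.real Set.univ := by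
  have := h.norm_fourierBorel_le hK (c := 0) fun ξ hξ =>
    re_mul_nonneg_of_dualSectorFun_nonneg h0 h1 hz (hKβ hξ)
  simpa using this

theorem IsSupportedOn.tendsto_fourierBorel_atTop (h : IsSupportedOn μ K) (hK : IsCompact K)
    (hKβ : K ⊆ closedSector β) :
    Filter.Tendsto (fun t : ℝ => fourierBorel μ t) Filter.atTop (nhds 0) := by
  obtain ⟨δ, hδ0, hδ⟩ := hK.exists_forall_le' Complex.continuous_re.continuousOn
    (a := 0) fun ξ hξ => (hKβ hξ).1
  have hlim : Filter.Tendsto (fun t : ℝ => Real.exp (-(δ * t)) * μ.variation.real Set.univ)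
      Filter.atTop (nhds (0 * μ.variation.real Set.univ)) :=
    (Real.tendsto_exp_neg_atTop_nhds_zero.comp
      (Filter.tendsto_id.const_mul_atTop hδ0)).mul_const _
  rw [zero_mul] at hlim
  refine squeeze_zero_norm' ?_ hlim
  filter_upwards [Filter.eventually_ge_atTop 0] with t ht
  refine h.norm_fourierBorel_le hK fun ξ hξ => ?_
  rw [Complex.re_ofReal_mul, mul_comm]
  exact mul_le_mul_of_nonneg_left (hδ ξ hξ) ht

/-- A boundary point `exp (± i β)` of the sector `V_β` that realizes `dualSectorFun β z`. -/
theorem exists_mem_closedSector_re_mul_eq (h0 : 0 < β) (h1 : β < Real.pi / 2) (z : ℂ) :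
    ∃ ζ ∈ closedSector β, ‖ζ‖ = 1 ∧ (z * ζ).re = dualSectorFun β z := by
  have hs : 0 < Real.sin β := Real.sin_pos_of_pos_of_lt_pi h0 (by linarith [Real.pi_pos])
  have hc : 0 < Real.cos β := Real.cos_pos_of_mem_Ioo ⟨by linarith, h1⟩
  have hn : ∀ σ : ℝ, σ ^ 2 = 1 → ‖(⟨Real.cos β, σ * Real.sin β⟩ : ℂ)‖ = 1 := fun σ hσ => by
    rw [← sq_eq_sq₀ (norm_nonneg _) zero_le_one, Complex.sq_norm, Complex.normSq_apply]
    simp only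
    nlinarith [Real.sin_sq_add_cos_sq β]
  rcases le_or_gt 0 z.im with hz | hz
  · refine ⟨⟨Real.cos β, 1 * Real.sin β⟩, (mem_closedSector_iff h0 h1).2 ⟨hc, ?_⟩,
      hn 1 (by norm_num), ?_⟩
    · simp only [one_mul, abs_of_pos hs]
      rw [mul_comm]
    · simp [Complex.mul_re, dualSectorFun, abs_of_nonneg hz]
  · refine ⟨⟨Real.cos β, -1 * Real.sin β⟩, (mem_closedSector_iff h0 h1).2 ⟨hc, ?_⟩,
      hn (-1) (by norm_num), ?_⟩
    · simp only [neg_mul, one_mul, abs_neg, abs_of_pos hs]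
      rw [mul_comm]
    · simp [Complex.mul_re, dualSectorFun, abs_of_neg hz]

/-- The lower estimate near the origin, in an arbitrary Banach algebra. -/
theorem IsAlgAnalyticSemigroup.exists_lt_norm_complexIntegral {A : Type*} [NormedRing A]
    [NormedAlgebra ℂ A] [CompleteSpace A] {α M : ℝ} {T : ℂ → A}
    (hT : IsAlgAnalyticSemigroup α T) (hβ : 0 < β) (hβα : β < α) (hα : α < Real.pi / 2)
    (hM : ∀ t ∈ openSector α, ‖T t‖ ≤ M) (hq : spectralRadius ℂ (T 1) = 0)
    (hne : ∃ t ∈ openSector α, T t ≠ 0) (hK : IsCompact K) (hKβ : K ⊆ closedSector β)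
    (hμK : IsSupportedOn μ K) (hsymm : IsSymmetricMeasure μ) (hmass : μ K = 0) {b : ℝ}
    (hb : 0 < b) (hFb : 0 < ‖fourierBorel μ b‖)
    (hmax : ∀ t : ℝ, 0 < t → ‖fourierBorel μ t‖ ≤ ‖fourierBorel μ b‖) :
    ∃ η : ℝ, 0 < η ∧ ∀ u ∈ openSector (α - β), ‖u‖ ≤ η →
      ‖fourierBorel μ b‖ < ‖complexIntegral μ fun ξ => T (u * ξ)‖ := by
  have h0 : 0 < α := hβ.trans hβα
  have hβ1 : β < Real.pi / 2 := hβα.trans hα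
  have hM0 : 0 ≤ M := (norm_nonneg _).trans (hM _ (ofReal_mem_openSector h0 one_pos))
  obtain ⟨R, hR⟩ := hK.isBounded.exists_norm_le
  obtain ⟨r, hr0, C, hC⟩ := exists_uniform_bound_on_sphere (E := A) (F := fourierBorel μ)
    (C₁ := M) (D := R * M * μ.variation.real Set.univ) (κ := 2 * R)
    hβ hβ1 (hμK.differentiable_fourierBorel hK) (hμK.fourierBorel_zero hK hmass)
    (hμK.fourierBorel_conj hK hsymm)
    (fun z hz => hμK.norm_fourierBorel_le_of_dualSectorFun_nonneg hK hKβ hβ hβ1 hz)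
    hb hFb hmax hM0
  set L : ℂ → A := laplaceResolvent T with hL
  have hLd : Differentiable ℂ L := hT.differentiable_laplaceResolvent h0 hM hq
  have hL0 : 0 < ‖L 0‖ := norm_pos_iff.2 (hT.laplaceResolvent_ne_zero h0 hα hM hq hne 0)
  -- C need not be positive, and η divides by it. The factor 2 in η makes the final inequality ‖L 0‖
  -- ≤ ‖L 0‖ / 2.
  set C' : ℝ := max C 1 with hC'
  have hC'0 : 0 < C' := lt_max_of_lt_right one_pos
  refine ⟨‖L 0‖ / (2 * C'), by positivity, fun u hu huη => ?_⟩
  by_contra! hcon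
  have hu0 : u ≠ 0 := fun h => by simpa [h] using hu.1
  have hun : 0 < ‖u‖ := norm_pos_iff.2 hu0
  -- With this scaling both resolvent bounds become independent of u, while ‖f 0‖ = ‖L 0‖ / ‖u‖
  -- blows up as u → 0.
  set f : ℂ → A := fun z => u⁻¹ • L (z / u) with hf
  have hfd : Differentiable ℂ f := (hLd.comp (differentiable_id.div_const u)).const_smul u⁻¹
  have hfn : ∀ z, ‖f z‖ = ‖u‖⁻¹ * ‖L (z / u)‖ := fun z => by
    rw [hf]
    simp only
    rw [norm_smul, norm_inv]
  have hf1 : ∀ z, dualSectorFun β z < 0 → ‖f z‖ ≤ M / (-dualSectorFun β z) := by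
    intro z hz
    obtain ⟨ζ, hζ, hζn, hζz⟩ := exists_mem_closedSector_re_mul_eq hβ hβ1 z
    have huζ := mul_mem_openSector hα hu hζ
    have heq : z / u * (u * ζ) = z * ζ := by field_simp
    have := hT.norm_laplaceResolvent_le h0 hα hM hq huζ (s := z / u) (by rw [heq, hζz]; exact hz)
    rw [heq, hζz, norm_mul, hζn, mul_one] at this
    rw [hfn, inv_mul_le_iff₀ hun, ← mul_div_assoc]
    exact this
  have hf2 : ∀ z, (‖fourierBorel μ z‖ - ‖fourierBorel μ b‖) * ‖f z‖ ≤
      R * M * μ.variation.real Set.univ * Real.exp (2 * R * ‖z‖) := by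
    intro z
    have := hT.sub_mul_norm_laplaceResolvent_le h0 hα hM hq hK hKβ hμK hR hu z hcon
    rw [hfn, mul_left_comm, inv_mul_le_iff₀ hun]
    refine this.trans (le_of_eq ?_)
    rw [show 2 * (‖z‖ * R) = 2 * R * ‖z‖ by ring]
    ring
  have hf0 : ‖f 0‖ ≤ C' := by
    refine Complex.norm_le_of_forall_mem_frontier_norm_le (Metric.isBounded_ball (x := 0) (r := r))
      hfd.diffContOnCl (fun z hz => ?_) (subset_closure (Metric.mem_ball_self hr0))
    rw [frontier_ball _ hr0.ne'] at hz
    exact (hC f hfd hf1 hf2 z (by simpa using hz)).trans (le_max_left _ _)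
  rw [hfn, zero_div, inv_mul_le_iff₀ hun] at hf0
  have h3 : ‖u‖ * C' ≤ ‖L 0‖ / (2 * C') * C' := by gcongr
  have h4 : ‖L 0‖ / (2 * C') * C' = ‖L 0‖ / 2 := by field_simp
  linarith

end MainTheorem

theorem mainTheorem2 {X : Type*} [NormedAddCommGroup X] [NormedSpace ℂ X] [CompleteSpace X]
    (α β : ℝ) (hβ : 0 < β) (hβα : β < α) (hα : α < Real.pi / 2)
    (T : ℂ → X →L[ℂ] X) (hT : IsAnalyticSemigroup α T)
    (hnontrivial : ∃ t ∈ openSector α, T t ≠ 0)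
    (hbounded : ∃ M : ℝ, ∀ t ∈ openSector α, ‖T t‖ ≤ M)
    (hquasinilpotent : ∀ t ∈ openSector α, spectralRadius ℂ (T t) = 0)
    (μ : ComplexMeasure ℂ) (K : Set ℂ) (hK : IsCompact K) (hKβ : K ⊆ closedSector β)
    (hμK : IsSupportedOn μ K) (hsymm : IsSymmetricMeasure μ) (hmass : μ K = 0)
    (hF : ∃ z : ℂ, fourierBorel μ z ≠ 0) :
    BddAbove (Set.range fun t : Set.Ioi (0 : ℝ) => ‖fourierBorel μ ((t : ℝ) : ℂ)‖) ∧
      ∃ η : ℝ, 0 < η ∧ ∀ u ∈ openSector (α - β), ‖u‖ ≤ η →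
        μ.Integrable (fun ξ : ℂ => T (u * ξ)) ∧
        ‖transformOfGenerator μ T u‖ >
          ⨆ t : Set.Ioi (0 : ℝ), ‖fourierBorel μ ((t : ℝ) : ℂ)‖ := by
  have h0 : 0 < α := hβ.trans hβα
  have hT' : IsAlgAnalyticSemigroup α T := ⟨hT.analytic, hT.map_add⟩
  have hq : spectralRadius ℂ (T 1) = 0 :=
    hquasinilpotent 1 (by simpa using ofReal_mem_openSector h0 one_pos)
  obtain ⟨M, hM⟩ := hbounded
  obtain ⟨b, hb, hFb, hmax⟩ := exists_norm_max_of_tendsto_zero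
    (hμK.differentiable_fourierBorel hK) (hμK.fourierBorel_zero hK hmass)
    (hμK.tendsto_fourierBorel_atTop hK hKβ) hF
  refine ⟨⟨‖fourierBorel μ b‖, ?_⟩, ?_⟩
  · rintro _ ⟨t, rfl⟩
    exact hmax t t.2
  obtain ⟨η, hη, hlt⟩ := hT'.exists_lt_norm_complexIntegral hβ hβα hα hM hq hnontrivial hK hKβ
    hμK hsymm hmass hb hFb hmax
  refine ⟨η, hη, fun u hu huη => ⟨hT'.integrable_comp_mul hα hK hKβ hμK hu, ?_⟩⟩
  have : Nonempty (Set.Ioi (0 : ℝ)) := ⟨⟨b, hb⟩⟩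
  exact (ciSup_le fun t : Set.Ioi (0 : ℝ) => hmax t t.2).trans_lt (hlt u hu huη)
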